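/- Theorem 7.20 (with Theorem 7.21). Let \(N\ge 1\) and let \(A=(a_{ij})_{i,j=1}^N\) be an unnormalized GUE(\(N\)) random matrix, i.e. \(A=A^*\), the entries \(a_{ij}\) with \(i\ge j\) are independent, each \(a_{ii}\) is a standard real Gaussian, and each \(a_{ij}\) with \(i>j\) is a standard complex Gaussian (distributed as \((X+iY)/\sqrt2\) with \(X,Y\) independent standard real Gaussians). Let \(H_k\) be the \(k\)-th probabilists' Hermite polynomial (the monic polynomial of degree \(k\) determined by \(H_0(x)=1\), \(H_{k+1}(x)=xH_k(x)-H_k'(x)\); these are orthogonal with respect to \(e^{-x^2/2}dx\)), and put \[ \Psi_k(x)=(2\pi)^{-1/4}(k!)^{-1/2}e^{-x^2/4}H_k(x),\qquad K_N(x,y)=\sum_{k=0}^{N-1}\Psi_k(x)\Psi_k(y). \] 1. The joint distribution on \(\mathbb R^N\) of the unordered eigenvalues of \(A\) (the eigenvalues, counted with multiplicity, listed in a uniformly random order independent of \(A\)) has with respect to Lebesgue measure the density \[ p(\mu_1,\dots,\mu_N)=\frac1{N!}\det\bigl(K_N(\mu_i,\mu_j)\bigr)_{i,j=1}^N . \]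 2. The averaged eigenvalue distribution of \(A\), i.e. the probability measure \(\mathbb E\bigl[\frac1N\sum_{i=1}^N\delta_{\mu_i}\bigr]\) on \(\mathbb R\), where \(\mu_1,\dots,\mu_N\) are the eigenvalues of \(A\), has with respect to Lebesgue measure the density \[ p_N(\mu)=\frac1N K_N(\mu,\mu)=\frac1N\sum_{k=0}^{N-1}\Psi_k(\mu)^2=\frac1{\sqrt{2\pi}}\,\frac1N\sum_{k=0}^{N-1}\frac1{k!}H_k(\mu)^2e^{-\mu^2/2}. \] -/

import Mathlib

open MeasureTheory ProbabilityTheory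
open scoped ENNReal Nat

noncomputable section

/-- The law on `ℂ` of a standard complex Gaussian `(X + iY) / √2`, where `X` and `Y` are independent
standard real Gaussians. -/
def stdComplexGaussian : Measure ℂ :=
  ((gaussianReal 0 1).prod (gaussianReal 0 1)).map
    fun p : ℝ × ℝ => ((p.1 : ℂ) + Complex.I * (p.2 : ℂ)) / ((√2 : ℝ) : ℂ)

/-- `a` is an unnormalized GUE(N) random matrix on the probability space `(Ω, P)`: it is selfadjoint,
the entries `a i j` with `j ≤ i` are independent, the (real) diagonal entries are standard real
Gaussians and the entries below the diagonal are standard complex Gaussians. (The normalized GUE(N)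
matrix is then `a / √N`.) -/
structure IsUnnormalizedGUE {Ω : Type*} [MeasurableSpace Ω] (P : Measure Ω) {N : ℕ}
    (a : Ω → Matrix (Fin N) (Fin N) ℂ) : Prop where
  isHermitian : ∀ ω, (a ω).IsHermitian
  indep : iIndepFun
    (fun (p : {p : Fin N × Fin N // p.2 ≤ p.1}) (ω : Ω) => a ω p.1.1 p.1.2) P
  diag : ∀ i, HasLaw (fun ω => (a ω i i).re) (gaussianReal 0 1) P
  offDiag : ∀ i j, j < i → HasLaw (fun ω => a ω i j) stdComplexGaussian P

/-- The joint law on `ℝ^N` of the unordered eigenvalues, counted with multiplicity, of a selfadjoint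
random matrix: the average over all `N!` labellings `σ` of the joint law of
`(μ_{σ(1)}, …, μ_{σ(N)})`. In other words, the eigenvalues are listed in a uniformly random order
that is independent of the matrix. -/
def unorderedEigenvalueLaw {Ω : Type*} [MeasurableSpace Ω] (P : Measure Ω) {N : ℕ}
    (a : Ω → Matrix (Fin N) (Fin N) ℂ) (ha : ∀ ω, (a ω).IsHermitian) : Measure (Fin N → ℝ) :=
  (N ! : ℝ≥0∞)⁻¹ • ∑ σ : Equiv.Perm (Fin N),
    P.map (fun ω (i : Fin N) => (ha ω).eigenvalues (σ i))

/-- The eigenvalue distribution `(1/N) (δ_{μ_1} + ⋯ + δ_{μ_N})` of a selfadjoint matrix, where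
`μ_1, …, μ_N` are its eigenvalues, counted with multiplicity. -/
def eigenvalueDistribution {N : ℕ} {A : Matrix (Fin N) (Fin N) ℂ} (hA : A.IsHermitian) :
    Measure ℝ :=
  (N : ℝ≥0∞)⁻¹ • ∑ i : Fin N, Measure.dirac (hA.eigenvalues i)

/-- The averaged eigenvalue distribution of a selfadjoint random matrix: the expectation of its
eigenvalue distribution, that is, `B ↦ ∫ (eigenvalueDistribution of a ω)(B) dP(ω)`. -/
def averagedEigenvalueDistribution {Ω : Type*} [MeasurableSpace Ω] (P : Measure Ω) {N : ℕ}
    (a : Ω → Matrix (Fin N) (Fin N) ℂ) (ha : ∀ ω, (a ω).IsHermitian) : Measure ℝ :=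
  P.bind fun ω => eigenvalueDistribution (ha ω)

/-- The value at `x` of the `n`-th (monic, probabilists') Hermite polynomial. -/
def hermiteH (n : ℕ) (x : ℝ) : ℝ := Polynomial.aeval x (Polynomial.hermite n)

/-- The `n`-th Hermite function. -/
def hermitePsi (n : ℕ) (x : ℝ) : ℝ :=
  (2 * Real.pi) ^ (-(1 / 4) : ℝ) * (n ! : ℝ) ^ (-(1 / 2) : ℝ) * Real.exp (-(1 / 4) * x ^ 2) *
    hermiteH n x

/-- The `N`-th Hermite kernel. -/
def hermiteKernel (N : ℕ) (x y : ℝ) : ℝ :=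
  ∑ k ∈ Finset.range N, hermitePsi k x * hermitePsi k y

/-- `p` is a density of the measure `m` with respect to Lebesgue measure: `p` is nonnegative and
`m = p dx`. -/
def HasLebesgueDensity {E : Type*} [MeasureSpace E] (m : Measure E) (p : E → ℝ) : Prop :=
  Measurable p ∧ (∀ x, 0 ≤ p x) ∧ m = volume.withDensity fun x => ENNReal.ofReal (p x)

end

open MeasureTheory ProbabilityTheory
open scoped ENNReal Nat

noncomputable section

/-! ### Decreasing enumeration of the spectrum -/

/-! The ordered spectrum is built up one dimension at a time. A GUE matrix of size `n + 1` is a GUE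
matrix of size `n` with an independent border: a real Gaussian corner and a complex Gaussian vector.
That vector has a unitarily invariant law, so the minor may be diagonalized, with eigenvalues `l`.
The characteristic polynomial then depends only on `l`, the corner, and the squared moduli of the
border entries, which are independent exponentials.

For fixed `l`, the spectra `μ` strictly interlaced by `l` correspond injectively to corners and
squared moduli. The Jacobian of this map is `V(μ) / V(l)` in absolute value, with `V` the absolute
Vandermonde determinant (`abs_det_interlacingJacobian`), and comparing traces of squares turns the
weight of the border into `exp ((∑ l² - ∑ μ²) / 2)` (`sum_sq_eq_of_mem_interlacingBox`). Against the
density for `l`, proportional to `V(l)² exp (-∑ l² / 2)`, this leaves `V(l) V(μ) exp (-∑ μ² / 2)`.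
Integrating `V(l)` over the interlacing box gives `V(μ) / n!`
(`lintegral_absVandermonde_interlacingBox`), and the induction closes.

Surjectivity of the change of variables is never proved, so the induction yields only that the
ordered spectrum has at least the claimed density (`lintegral_orderedDensity_le`). Equality comes
from total mass: row operations identify the density with `det (Ψ_j(μ_i))²`, whose integral over all
of space is `N!` because the Hermite functions are orthonormal. A probability measure dominated by
another equals it (`IsUnnormalizedGUE.lintegral_spectrumVec`).

Symmetrizing over permutations gives the unordered law, and the kernel determinant is the
determinant of `Ψ Ψᵀ`. The averaged distribution follows from integrating out all coordinates but
one, again by orthonormality (`integral_det_sq_pi`). -/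

theorem antitone_eq_of_prod_sub_eq {n : ℕ} {μ ν : Fin n → ℝ} (hμ : Antitone μ) (hν : Antitone ν)
    (h : ∀ k : ℕ, ∏ i, ((k : ℝ) - μ i) = ∏ i, ((k : ℝ) - ν i)) : μ = ν := by
  have hp : (∏ i, (Polynomial.X - Polynomial.C (μ i))) =
      ∏ i, (Polynomial.X - Polynomial.C (ν i)) := by
    refine Polynomial.eq_of_infinite_eval_eq _ _ ?_
    refine (Set.infinite_range_of_injective (Nat.cast_injective (R := ℝ))).mono ?_
    rintro _ ⟨k, rfl⟩
    simpa [Polynomial.eval_prod] using h k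
  have hr := congrArg Polynomial.roots hp
  rw [Polynomial.roots_prod _ _ (Finset.prod_ne_zero_iff.2 fun i _ => Polynomial.X_sub_C_ne_zero _),
    Polynomial.roots_prod _ _ (Finset.prod_ne_zero_iff.2 fun i _ => Polynomial.X_sub_C_ne_zero _)] at hr
  simp only [Polynomial.roots_X_sub_C, Multiset.bind_singleton, Fin.univ_val_map,
    Multiset.coe_eq_coe] at hr
  exact List.ofFn_injective (hr.eq_of_sortedGE hμ.sortedGE_ofFn hν.sortedGE_ofFn)

theorem isClosed_setOf_antitone_fin (n : ℕ) : IsClosed {μ : Fin n → ℝ | Antitone μ} := by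
  simp only [Antitone, Set.ofPred_forall]
  refine isClosed_iInter fun i => isClosed_iInter fun j => isClosed_iInter fun _ => ?_
  exact isClosed_le (continuous_apply j) (continuous_apply i)

/-- Lusin–Souslin: a continuous injection from a Polish space is a measurable embedding, so its
inverse extends to a measurable function. Sampling the polynomial at the naturals determines it and
keeps the target a countable product. -/
theorem exists_measurable_antitone_roots (n : ℕ) :
    ∃ R : (ℕ → ℝ) → (Fin n → ℝ), Measurable R ∧
      ∀ μ : Fin n → ℝ, Antitone μ → R (fun k => ∏ i, ((k : ℝ) - μ i)) = μ := by
  let s : Set (Fin n → ℝ) := {μ | Antitone μ}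
  have hs : IsClosed s := isClosed_setOf_antitone_fin n
  have : PolishSpace s := hs.polishSpace
  let f : s → (ℕ → ℝ) := fun μ k => ∏ i, ((k : ℝ) - μ.1 i)
  have hf : Continuous f := continuous_pi fun k => by
    exact continuous_finsetProd _ fun i _ =>
      continuous_const.sub ((continuous_apply i).comp continuous_subtype_val)
  have hinj : Function.Injective f := fun μ ν h =>
    Subtype.ext (antitone_eq_of_prod_sub_eq μ.2 ν.2 fun k => congrFun h k)
  obtain ⟨R, hR, hRf⟩ := (hf.measurableEmbedding hinj).exists_measurable_extend
    (measurable_subtype_coe (p := (· ∈ s))) fun _ => inferInstance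
  exact ⟨R, hR, fun μ hμ => congrFun hRf ⟨μ, hμ⟩⟩

/-- The decreasing enumeration of the roots of a real-rooted monic polynomial of degree `n`, as a
measurable function of the values of the polynomial at the natural numbers. -/
def antitoneRoots (n : ℕ) : (ℕ → ℝ) → (Fin n → ℝ) :=
  (exists_measurable_antitone_roots n).choose

/-- The decreasing enumeration of the eigenvalues of a matrix with real spectrum, as a measurable
function of the entries. -/
def spectrumVec {n : ℕ} (A : Fin n → Fin n → ℂ) : Fin n → ℝ :=
  antitoneRoots n fun k => ((Matrix.scalar (Fin n) (k : ℂ)) - Matrix.of A).det.re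

theorem measurable_spectrumVec {n : ℕ} :
    Measurable (spectrumVec : (Fin n → Fin n → ℂ) → (Fin n → ℝ)) := by
  refine (exists_measurable_antitone_roots n).choose_spec.1.comp ?_
  refine measurable_pi_lambda _ fun k => Continuous.measurable ?_
  refine Complex.continuous_re.comp (Continuous.matrix_det ?_)
  exact continuous_const.sub continuous_id

theorem spectrumVec_eq {n : ℕ} {A : Fin n → Fin n → ℂ} {μ : Fin n → ℝ} (hμ : Antitone μ)
    (h : ∀ k : ℕ, ((Matrix.scalar (Fin n) (k : ℂ)) - Matrix.of A).det =
      ∏ i, ((k : ℂ) - (μ i : ℂ))) : spectrumVec A = μ := by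
  rw [spectrumVec]
  refine Eq.trans ?_ ((exists_measurable_antitone_roots n).choose_spec.2 μ hμ)
  refine congrArg (antitoneRoots n) (funext fun k => ?_)
  rw [h k]
  norm_cast

theorem spectrumVec_congr {n : ℕ} {A B : Fin n → Fin n → ℂ}
    (h : ∀ k : ℂ, ((Matrix.scalar (Fin n) k) - Matrix.of A).det =
      ((Matrix.scalar (Fin n) k) - Matrix.of B).det) : spectrumVec A = spectrumVec B := by
  simp only [spectrumVec, h]

/-- `eigenvalues` is the decreasing list `eigenvalues₀` read through an arbitrary bijection of index
types. The point is that this bijection does not depend on the matrix, so measurability transfers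
and the permutation can be absorbed by symmetrization. -/
theorem exists_perm_eigenvalues_eq {n : ℕ} :
    ∃ τ : Equiv.Perm (Fin n), ∀ (A : Matrix (Fin n) (Fin n) ℂ) (hA : A.IsHermitian),
      hA.eigenvalues = spectrumVec (fun i j => A i j) ∘ τ := by
  let e : Fin (Fintype.card (Fin n)) ≃ Fin n := Fintype.equivOfCardEq (Fintype.card_fin _)
  let f : Fin (Fintype.card (Fin n)) ≃ Fin n := finCongr (Fintype.card_fin n)
  refine ⟨e.symm.trans f, fun A hA => ?_⟩
  have key : spectrumVec (fun i j => A i j) = hA.eigenvalues₀ ∘ f.symm := by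
    refine spectrumVec_eq ?_ fun k => ?_
    · intro i j hij
      exact hA.eigenvalues₀_antitone (by simpa [f] using hij)
    · have h1 := congrArg (Polynomial.eval (k : ℂ)) hA.charpoly_eq
      rw [Matrix.eval_charpoly, Polynomial.eval_prod] at h1
      refine h1.trans ?_
      simp only [Polynomial.eval_sub, Polynomial.eval_X, Polynomial.eval_C]
      rw [← (e.symm.trans f).prod_comp fun i => (k : ℂ) - (((hA.eigenvalues₀ ∘ f.symm) i : ℝ) : ℂ)]
      refine Finset.prod_congr rfl fun i _ => ?_
      simp [Matrix.IsHermitian.eigenvalues, e]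
  rw [key]
  ext i
  simp [Matrix.IsHermitian.eigenvalues, e]

/-! ### Bordered matrices -/

/-- The matrix with corner entry `x`, first column `v`, first row `v*` and lower right block `A`. -/
def bordered {n : ℕ} (A : Fin n → Fin n → ℂ) (v : Fin n → ℂ) (x : ℂ) :
    Fin (n + 1) → Fin (n + 1) → ℂ :=
  Fin.cons (Fin.cons x fun j => star (v j)) fun i => Fin.cons (v i) (A i)

theorem det_sub_bordered {n : ℕ} (A : Fin n → Fin n → ℂ) (v : Fin n → ℂ) (x z : ℂ) :
    (Matrix.scalar (Fin (n + 1)) z - Matrix.of (bordered A v x)).det =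
      (Matrix.fromBlocks (Matrix.of fun _ _ : Unit => z - x) (-Matrix.replicateRow Unit (star v))
        (-Matrix.replicateCol Unit v) (Matrix.scalar (Fin n) z - Matrix.of A)).det := by
  -- The bijection sends the unit to `0` and `i` to `i.succ`, exposing the block structure.
  let e : Unit ⊕ Fin n ≃ Fin (n + 1) :=
    ((Equiv.sumComm _ _).trans (Equiv.optionEquivSumPUnit _).symm).trans (finSuccEquiv n).symm
  rw [← Matrix.det_submatrix_equiv_self e]
  congr 1
  ext (i | i) (j | j)
  · simp [e, bordered]
  · simp [e, bordered, Fin.ext_iff]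
  · simp [e, bordered, Fin.ext_iff]
  · simp [e, bordered, Matrix.diagonal_apply, Fin.ext_iff]

/-- Conjugation by the block matrix `1 ⊕ U` preserves the characteristic polynomial and only rotates
the border vector. -/
theorem spectrumVec_bordered_conj {n : ℕ} {A D U : Matrix (Fin n) (Fin n) ℂ}
    (hU : U * star U = 1) (hA : A = U * D * star U) (v : Fin n → ℂ) (x : ℂ) :
    spectrumVec (bordered (fun i j => A i j) v x) =
      spectrumVec (bordered (fun i j => D i j) ((star U).mulVec v) x) := by
  refine spectrumVec_congr fun z => ?_
  rw [det_sub_bordered, det_sub_bordered]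
  have key : Matrix.fromBlocks (Matrix.of fun _ _ : Unit => z - x)
      (-Matrix.replicateRow Unit (star v)) (-Matrix.replicateCol Unit v)
      (Matrix.scalar (Fin n) z - Matrix.of fun i j => A i j) =
      Matrix.fromBlocks 1 0 0 U * Matrix.fromBlocks (Matrix.of fun _ _ : Unit => z - x)
        (-Matrix.replicateRow Unit (star ((star U).mulVec v)))
        (-Matrix.replicateCol Unit ((star U).mulVec v))
        (Matrix.scalar (Fin n) z - Matrix.of fun i j => D i j) *
        Matrix.fromBlocks 1 0 0 (star U) := by
    rw [Matrix.fromBlocks_multiply, Matrix.fromBlocks_multiply]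
    have h3 : (Matrix.scalar (Fin n) z - Matrix.of fun i j => A i j) =
        U * (Matrix.scalar (Fin n) z - Matrix.of fun i j => D i j) * star U := by
      have : (Matrix.of fun i j => A i j) = U * (Matrix.of fun i j => D i j) * star U := hA
      rw [this, mul_sub, sub_mul, ← (Matrix.scalar_commute z (fun _ => mul_comm _ _) U).eq, mul_assoc _ U,
        hU, mul_one]
    simp only [Matrix.one_mul, Matrix.mul_one, Matrix.zero_mul, Matrix.mul_zero, add_zero, zero_add,
      Matrix.mul_neg, Matrix.neg_mul, h3]
    have h1 : Matrix.replicateRow Unit (star ((star U).mulVec v)) * star U =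
        Matrix.replicateRow Unit (star v) := by
      rw [← Matrix.replicateRow_vecMul, Matrix.star_mulVec, Matrix.vecMul_vecMul,
        ← Matrix.star_eq_conjTranspose, star_star, hU, Matrix.vecMul_one]
    have h2 : U * Matrix.replicateCol Unit ((star U).mulVec v) = Matrix.replicateCol Unit v := by
      rw [← Matrix.replicateCol_mulVec, Matrix.mulVec_mulVec, hU, Matrix.one_mulVec]
    simp only [h1, h2, neg_zero, add_zero, zero_add]
  rw [key, Matrix.det_mul, Matrix.det_mul, Matrix.det_fromBlocks_zero₂₁,
    Matrix.det_fromBlocks_zero₂₁, mul_right_comm, mul_assoc, mul_assoc]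
  rw [Matrix.det_one, one_mul, one_mul, ← mul_assoc, ← Matrix.det_mul, hU, Matrix.det_one, one_mul]

/-- Schur complement when `z` avoids every `l i`; both sides are continuous in `z` and such `z` are
dense. The border enters only through its squared moduli. -/
theorem det_sub_bordered_diagonal {n : ℕ} (l v : Fin n → ℂ) (x z : ℂ) :
    (Matrix.scalar (Fin (n + 1)) z - Matrix.of (bordered (fun i j => Matrix.diagonal l i j) v x)).det =
      (z - x) * ∏ i, (z - l i) - ∑ i, star (v i) * v i * ∏ k ∈ Finset.univ.erase i, (z - l k) := by
  let s : Set ℂ := (Set.range l)ᶜ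
  have hs : Dense s := (Set.finite_range l).countable.dense_compl ℝ
  refine congrFun (Continuous.ext_on hs (f := fun z =>
    (Matrix.scalar (Fin (n + 1)) z - Matrix.of (bordered (fun i j => Matrix.diagonal l i j) v x)).det)
    (g := fun z => (z - x) * ∏ i, (z - l i) -
      ∑ i, star (v i) * v i * ∏ k ∈ Finset.univ.erase i, (z - l k)) ?_ ?_ ?_) z
  · refine Continuous.matrix_det (Continuous.sub ?_ continuous_const)
    exact Continuous.matrix_diagonal (continuous_pi fun _ => continuous_id)
  · fun_prop
  · intro z hz
    have hz' : ∀ i, z - l i ≠ 0 := fun i h => hz ⟨i, (sub_eq_zero.1 h).symm⟩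
    simp only [det_sub_bordered]
    have hD : (Matrix.scalar (Fin n) z - Matrix.of fun i j => Matrix.diagonal l i j) =
        Matrix.diagonal fun i => z - l i := by
      ext i j
      by_cases h : i = j <;> simp [h]
    rw [hD]
    have hinv : (Matrix.diagonal fun i => (z - l i)⁻¹) * (Matrix.diagonal fun i => z - l i) = 1 := by
      rw [Matrix.diagonal_mul_diagonal]
      simp [hz']
    let inst : Invertible (Matrix.diagonal fun i => z - l i) :=
      ⟨Matrix.diagonal fun i => (z - l i)⁻¹, hinv, mul_eq_one_comm.1 hinv⟩
    rw [Matrix.det_fromBlocks₂₂, Matrix.det_diagonal, Matrix.det_unique]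
    have : ⅟(Matrix.diagonal fun i => z - l i) = Matrix.diagonal fun i => (z - l i)⁻¹ := rfl
    rw [this]
    simp only [Matrix.neg_mul, Matrix.mul_neg, neg_neg, Matrix.sub_apply, Matrix.of_apply]
    rw [Matrix.mul_apply]
    simp only [Matrix.replicateRow_apply, Matrix.replicateCol_apply, Matrix.mul_diagonal,
      Pi.star_apply]
    rw [mul_sub, mul_comm, Finset.mul_sum]
    congr 1
    refine Finset.sum_congr rfl fun i _ => ?_
    rw [← Finset.mul_prod_erase _ _ (Finset.mem_univ i)]
    field_simp [hz' i]

/-! ### Interlacing sequences -/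

/-- The set of sequences `l` which strictly interlace `μ`. -/
def interlacingBox {n : ℕ} (μ : Fin (n + 1) → ℝ) : Set (Fin n → ℝ) :=
  Set.pi Set.univ fun i => Set.Ioo (μ i.succ) (μ i.castSucc)

theorem strictAnti_of_mem_interlacingBox {n : ℕ} {μ : Fin (n + 1) → ℝ} {l : Fin n → ℝ}
    (h : l ∈ interlacingBox μ) : StrictAnti μ :=
  Fin.strictAnti_iff_succ_lt.2 fun i => (h i trivial).1.trans (h i trivial).2

theorem strictAnti_left_of_mem_interlacingBox {n : ℕ} {μ : Fin (n + 1) → ℝ} {l : Fin n → ℝ}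
    (h : l ∈ interlacingBox μ) : StrictAnti l := by
  cases n with
  | zero => exact fun i => i.elim0
  | succ n =>
    refine Fin.strictAnti_iff_succ_lt.2 fun i => ?_
    have h1 := (h i.succ trivial).2
    have h2 := (h i.castSucc trivial).1
    rw [← Fin.succ_castSucc] at h1
    exact h1.trans h2

/-- The absolute value of the Vandermonde determinant. -/
def absVandermonde {n : ℕ} (μ : Fin n → ℝ) : ℝ := |(Matrix.vandermonde μ).det|

theorem absVandermonde_nonneg {n : ℕ} (μ : Fin n → ℝ) : 0 ≤ absVandermonde μ := abs_nonneg _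

theorem absVandermonde_pos {n : ℕ} {μ : Fin n → ℝ} (h : Function.Injective μ) :
    0 < absVandermonde μ :=
  abs_pos.2 (Matrix.det_vandermonde_ne_zero_iff.2 h)

theorem absVandermonde_eq_prod {n : ℕ} (μ : Fin n → ℝ) :
    absVandermonde μ = ∏ i, ∏ j ∈ Finset.Ioi i, |μ j - μ i| := by
  simp_rw [absVandermonde, Matrix.det_vandermonde, Finset.abs_prod]

theorem abs_prod_prod_erase_sub {n : ℕ} (μ : Fin n → ℝ) :
    |∏ i, ∏ j ∈ Finset.univ.erase i, (μ i - μ j)| = absVandermonde μ ^ 2 := by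
  simp_rw [absVandermonde_eq_prod, Finset.abs_prod]
  have h : ∀ i : Fin n, ∏ j ∈ Finset.univ.erase i, |μ i - μ j| =
      (∏ j ∈ Finset.Iio i, |μ i - μ j|) * ∏ j ∈ Finset.Ioi i, |μ i - μ j| := by
    intro i
    rw [← Finset.prod_union (Finset.disjoint_left.2 fun j h1 h2 =>
      lt_asymm (Finset.mem_Iio.1 h1) (Finset.mem_Ioi.1 h2))]
    refine Finset.prod_congr (Finset.ext fun j => ?_) fun _ _ => rfl
    simp
  simp_rw [h, Finset.prod_mul_distrib, sq]
  congr 1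
  · exact Finset.prod_comm' fun i j => by simp
  · exact Finset.prod_congr rfl fun i _ => Finset.prod_congr rfl fun j _ => abs_sub_comm _ _

/-- The weights `r i` such that `∏ (z - μ j) = (z - x) ∏ (z - l i) - ∑ r i ∏_{k ≠ i} (z - l k)`. -/
def interlacingWeight {n : ℕ} (l : Fin n → ℝ) (μ : Fin (n + 1) → ℝ) (i : Fin n) : ℝ :=
  -(∏ j, (l i - μ j)) / ∏ k ∈ Finset.univ.erase i, (l i - l k)

/-- Apart from its two neighbours, which enclose `l i`, each `μ` is paired with an `l k` on the same
side of `l i`, so every remaining quotient is positive. -/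
theorem interlacingWeight_pos {n : ℕ} {μ : Fin (n + 1) → ℝ} {l : Fin n → ℝ}
    (h : l ∈ interlacingBox μ) (i : Fin n) : 0 < interlacingWeight l μ i := by
  have hl := strictAnti_left_of_mem_interlacingBox h
  rw [interlacingWeight, Fin.prod_univ_succAbove _ i.castSucc,
    ← Finset.mul_prod_erase _ _ (Finset.mem_univ i), Fin.succAbove_castSucc_self]
  have hi := h i trivial
  have : -((l i - μ i.castSucc) * ((l i - μ i.succ) *
      ∏ x ∈ Finset.univ.erase i, (l i - μ (i.castSucc.succAbove x)))) /
      ∏ k ∈ Finset.univ.erase i, (l i - l k) =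
      ((μ i.castSucc - l i) * (l i - μ i.succ)) *
        ∏ k ∈ Finset.univ.erase i, ((l i - μ (i.castSucc.succAbove k)) / (l i - l k)) := by
    rw [Finset.prod_div_distrib]
    ring
  rw [this]
  refine mul_pos (mul_pos (sub_pos.2 hi.2) (sub_pos.2 hi.1)) (Finset.prod_pos fun k hk => ?_)
  have hk' := h k trivial
  rcases lt_or_gt_of_ne (Finset.ne_of_mem_erase hk) with hki | hki
  · rw [Fin.succAbove_of_castSucc_lt _ _ (by simpa using hki)]
    have h1 := hl hki
    exact div_pos_of_neg_of_neg (by linarith [hk'.2]) (by linarith)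
  · rw [Fin.succAbove_of_le_castSucc _ _ (by simpa using hki.le)]
    have h1 := hl hki
    exact div_pos (by linarith [hk'.1]) (by linarith)

/-- Lagrange interpolation at the `l i`. Choosing the corner as the difference of traces makes the
two leading coefficients agree, so the remainder has degree below `n` and is fixed by its `n`
values. -/
theorem prod_X_sub_C_eq_of_interlacing {n : ℕ} {l : Fin n → ℝ} (hl : Function.Injective l)
    (μ : Fin (n + 1) → ℝ) :
    ∏ j, (Polynomial.X - Polynomial.C (μ j)) =
      (Polynomial.X - Polynomial.C (∑ j, μ j - ∑ i, l i)) * ∏ i, (Polynomial.X - Polynomial.C (l i)) -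
      ∑ i, Polynomial.C (interlacingWeight l μ i) *
        ∏ k ∈ Finset.univ.erase i, (Polynomial.X - Polynomial.C (l k)) := by
  set p : Polynomial ℝ := ∏ j, (Polynomial.X - Polynomial.C (μ j)) with hp
  set L : Polynomial ℝ := ∏ i, (Polynomial.X - Polynomial.C (l i)) with hL
  set q : Polynomial ℝ := (Polynomial.X - Polynomial.C (∑ j, μ j - ∑ i, l i)) * L with hq
  have hpm : p.Monic := Polynomial.monic_prod_of_monic _ _ fun i _ => Polynomial.monic_X_sub_C _
  have hLm : L.Monic := Polynomial.monic_prod_of_monic _ _ fun i _ => Polynomial.monic_X_sub_C _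
  have hLd : L.natDegree = n := by simp [hL]
  have hpd : p.natDegree = n + 1 := by simp [hp]
  have hqm : q.Monic := (Polynomial.monic_X_sub_C _).mul hLm
  have hqd : q.natDegree = n + 1 := by
    rw [hq, (Polynomial.monic_X_sub_C _).natDegree_mul hLm, hLd, Polynomial.natDegree_X_sub_C, add_comm]
  have hpn : p.nextCoeff = -∑ j, μ j := Polynomial.prod_X_sub_C_nextCoeff _
  have hLn : L.nextCoeff = -∑ j, l j := Polynomial.prod_X_sub_C_nextCoeff _
  have hqn : q.nextCoeff = -∑ j, μ j := by
    rw [hq, (Polynomial.monic_X_sub_C _).nextCoeff_mul hLm, hLn, Polynomial.nextCoeff_X_sub_C]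
    ring
  have hc : ∀ m, n ≤ m → (p - q).coeff m = 0 := by
    intro m hm
    rw [Polynomial.coeff_sub]
    rcases hm.eq_or_lt with rfl | hm
    · have h1 := Polynomial.nextCoeff_of_natDegree_pos (p := p) (by omega)
      have h2 := Polynomial.nextCoeff_of_natDegree_pos (p := q) (by omega)
      rw [hpd, Nat.add_sub_cancel] at h1
      rw [hqd, Nat.add_sub_cancel] at h2
      rw [← h1, ← h2, hpn, hqn, sub_self]
    · rcases (Nat.succ_le_of_lt hm).eq_or_lt with rfl | hm
      · have h1 := hpm.coeff_natDegree
        have h2 := hqm.coeff_natDegree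
        rw [hpd] at h1
        rw [hqd] at h2
        rw [Nat.succ_eq_add_one, h1, h2, sub_self]
      · rw [Polynomial.coeff_eq_zero_of_natDegree_lt (by omega),
          Polynomial.coeff_eq_zero_of_natDegree_lt (by omega), sub_self]
  have hdeg1 : (p - q).degree < n := (Polynomial.degree_lt_iff_coeff_zero _ _).2 hc
  set s : Polynomial ℝ := ∑ i, Polynomial.C (interlacingWeight l μ i) *
        ∏ k ∈ Finset.univ.erase i, (Polynomial.X - Polynomial.C (l k)) with hs
  have hdeg2 : s.degree < n := by
    refine (Polynomial.degree_sum_le _ _).trans_lt ?_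
    rw [Finset.sup_lt_iff (by simp)]
    intro i _
    rw [← Polynomial.smul_eq_C_mul]
    refine (Polynomial.degree_smul_le _ _).trans_lt ?_
    rw [Polynomial.degree_prod]
    simp only [Polynomial.degree_X_sub_C, Finset.sum_const, Finset.card_erase_of_mem (Finset.mem_univ i),
      Finset.card_univ, Fintype.card_fin, nsmul_eq_mul, mul_one]
    have := i.pos
    exact_mod_cast Nat.sub_lt this one_pos
  have hz : p - q = -s := by
    refine Polynomial.eq_of_degrees_lt_of_eval_index_eq (Finset.univ : Finset (Fin n)) hl.injOn
      (by simpa using hdeg1) (by simpa using hdeg2) fun i _ => ?_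
    have hLi : L.eval (l i) = 0 := by
      rw [hL, Polynomial.eval_prod]
      exact Finset.prod_eq_zero (Finset.mem_univ i) (by simp)
    have hne : ∏ k ∈ Finset.univ.erase i, (l i - l k) ≠ 0 :=
      Finset.prod_ne_zero_iff.2 fun k hk => sub_ne_zero.2 fun h =>
        Finset.ne_of_mem_erase hk (hl h).symm
    rw [Polynomial.eval_sub, hq, Polynomial.eval_mul, hLi, mul_zero, sub_zero, Polynomial.eval_neg, hs,
      Polynomial.eval_finsetSum, Finset.sum_eq_single i]
    · simp only [hp, Polynomial.eval_mul, Polynomial.eval_C, Polynomial.eval_prod,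
        Polynomial.eval_sub, Polynomial.eval_X, interlacingWeight]
      field_simp
    · intro j _ hj
      rw [Polynomial.eval_mul, Polynomial.eval_prod]
      refine mul_eq_zero_of_right _ (Finset.prod_eq_zero (Finset.mem_erase.2 ⟨hj.symm, Finset.mem_univ i⟩) ?_)
      simp
    · simp
  rw [← sub_add_cancel p q, hz]
  ring

theorem Matrix.IsHermitian.trace_mul_self_eq_sum {n : ℕ} {A : Matrix (Fin n) (Fin n) ℂ}
    (hA : A.IsHermitian) : (A * A).trace = ∑ i, (hA.eigenvalues i : ℂ) ^ 2 := by
  conv_lhs => rw [hA.spectral_theorem, ← map_mul, Unitary.conjStarAlgAut_apply, Matrix.trace_mul_comm,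
    ← mul_assoc, Unitary.coe_star_mul_self, one_mul, Matrix.diagonal_mul_diagonal,
    Matrix.trace_diagonal]
  simp [sq]

theorem isHermitian_bordered {n : ℕ} {A : Fin n → Fin n → ℂ} (hA : (Matrix.of A).IsHermitian)
    (v : Fin n → ℂ) (x : ℝ) : (Matrix.of (bordered A v x)).IsHermitian := by
  ext i j
  refine Fin.cases ?_ (fun i => ?_) i <;> refine Fin.cases ?_ (fun j => ?_) j
  · simp [bordered]
  · simp [bordered]
  · simp [bordered]
  · simpa [bordered] using hA.apply i j

theorem spectrumVec_bordered_diagonal {n : ℕ} {μ : Fin (n + 1) → ℝ} {l : Fin n → ℝ}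
    (h : l ∈ interlacingBox μ) {w : Fin n → ℂ}
    (hw : ∀ i, Complex.normSq (w i) = interlacingWeight l μ i) :
    spectrumVec (bordered (fun i j => Matrix.diagonal (fun i => (l i : ℂ)) i j) w
      ((∑ j, μ j - ∑ i, l i : ℝ) : ℂ)) = μ := by
  refine spectrumVec_eq (strictAnti_of_mem_interlacingBox h).antitone fun k => ?_
  rw [det_sub_bordered_diagonal]
  have h1 := congrArg (Polynomial.eval (k : ℝ)) (prod_X_sub_C_eq_of_interlacing
    (strictAnti_left_of_mem_interlacingBox h).injective μ)
  simp only [Polynomial.eval_sub, Polynomial.eval_mul, Polynomial.eval_prod, Polynomial.eval_X,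
    Polynomial.eval_C, Polynomial.eval_finsetSum] at h1
  have h2 : ∀ i, star (w i) * w i = ((interlacingWeight l μ i : ℝ) : ℂ) := fun i => by
    rw [← hw i, Complex.normSq_eq_conj_mul_self]
    rfl
  simp_rw [h2]
  have h3 := congrArg (fun t : ℝ => (t : ℂ)) h1
  push_cast at h3 ⊢
  exact h3.symm

/-- The trace of the square of the bordered diagonal matrix, computed from its eigenvalues and from
its entries. The border is taken to be the real square roots of the weights. -/
theorem sum_sq_eq_of_mem_interlacingBox {n : ℕ} {μ : Fin (n + 1) → ℝ} {l : Fin n → ℝ}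
    (h : l ∈ interlacingBox μ) :
    ∑ j, μ j ^ 2 = ∑ i, l i ^ 2 + (∑ j, μ j - ∑ i, l i) ^ 2 + 2 * ∑ i, interlacingWeight l μ i := by
  set w : Fin n → ℂ := fun i => (√(interlacingWeight l μ i) : ℝ) with hw
  have hw' : ∀ i, Complex.normSq (w i) = interlacingWeight l μ i := fun i => by
    rw [hw, Complex.normSq_ofReal, Real.mul_self_sqrt (interlacingWeight_pos h i).le]
  have hs := spectrumVec_bordered_diagonal h hw'
  set D : Fin n → Fin n → ℂ := fun i j => Matrix.diagonal (fun i => (l i : ℂ)) i j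
  have hD : (Matrix.of D).IsHermitian := by
    refine Matrix.isHermitian_diagonal_of_self_adjoint _ (funext fun i => ?_)
    simp
  have hB := isHermitian_bordered hD w (∑ j, μ j - ∑ i, l i)
  obtain ⟨τ, hτ⟩ := exists_perm_eigenvalues_eq (n := n + 1)
  have h1 := hB.trace_mul_self_eq_sum
  rw [hτ _ hB] at h1
  simp only [Function.comp_apply, Matrix.of_apply] at h1
  rw [hs, Equiv.sum_comp τ fun i => (μ i : ℂ) ^ 2] at h1
  rw [Matrix.trace, Fin.sum_univ_succ] at h1
  simp only [Matrix.diag_apply, Matrix.mul_apply, Fin.sum_univ_succ (n := n), Matrix.of_apply,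
    bordered, Fin.cons_zero, Fin.cons_succ] at h1
  have h2 : ∀ i, star (w i) * w i = ((interlacingWeight l μ i : ℝ) : ℂ) := fun i => by
    rw [← hw' i, Complex.normSq_eq_conj_mul_self]
    rfl
  have h3 : ∀ i, ∑ j, D i j * D j i = (l i : ℂ) ^ 2 := fun i => by
    rw [Finset.sum_eq_single i]
    · simp [D, sq]
    · intro j _ hj
      simp [D, Matrix.diagonal_apply_ne _ hj]
    · simp
  simp_rw [Finset.sum_add_distrib, h3, mul_comm (w _) (star _), h2, ← Fin.sum_univ_succ] at h1
  rw [Fin.sum_univ_succ fun i => μ i ^ 2]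
  have h4 : ((∑ j, μ j - ∑ i, l i) * (∑ j, μ j - ∑ i, l i) + ∑ i, interlacingWeight l μ i +
      (∑ i, interlacingWeight l μ i + ∑ i, l i ^ 2) : ℝ) = μ 0 ^ 2 + ∑ i : Fin n, μ i.succ ^ 2 := by
    exact_mod_cast h1
  rw [← h4]
  ring

/-- The corner entry and the squared moduli of the border entries of a bordered diagonal matrix
with prescribed spectrum. -/
def interlacingMap {n : ℕ} (l : Fin n → ℝ) (μ : Fin (n + 1) → ℝ) : Fin (n + 1) → ℝ :=
  Fin.cons (∑ j, μ j - ∑ i, l i) (interlacingWeight l μ)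

/-- Corner and squared moduli determine the bordered matrix up to phases, and its spectrum returns
`μ`. -/
theorem injOn_interlacingMap {n : ℕ} (l : Fin n → ℝ) :
    Set.InjOn (interlacingMap l) {μ | l ∈ interlacingBox μ} := by
  intro μ hμ ν hν hμν
  have h0 : ∑ j, μ j - ∑ i, l i = ∑ j, ν j - ∑ i, l i := congrFun hμν 0
  have h1 : ∀ i, interlacingWeight l μ i = interlacingWeight l ν i := fun i =>
    congrFun hμν i.succ
  have hw : ∀ i, Complex.normSq ((√(interlacingWeight l μ i) : ℝ) : ℂ) = interlacingWeight l μ i :=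
    fun i => by rw [Complex.normSq_ofReal, Real.mul_self_sqrt (interlacingWeight_pos hμ i).le]
  rw [← spectrumVec_bordered_diagonal hμ hw, h0]
  exact spectrumVec_bordered_diagonal hν fun i => (hw i).trans (h1 i)

/-- The Jacobian matrix of `interlacingMap l`. -/
def interlacingJacobian {n : ℕ} (l : Fin n → ℝ) (μ : Fin (n + 1) → ℝ) :
    Matrix (Fin (n + 1)) (Fin (n + 1)) ℝ :=
  Matrix.of (Fin.cons (fun _ => 1) fun i j =>
    (∏ k ∈ Finset.univ.erase i, (l i - l k))⁻¹ * ∏ k ∈ Finset.univ.erase j, (l i - μ k))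

theorem hasFDerivAt_interlacingMap {n : ℕ} (l : Fin n → ℝ) (μ : Fin (n + 1) → ℝ) :
    HasFDerivAt (interlacingMap l)
      (LinearMap.toContinuousLinearMap (Matrix.toLin' (interlacingJacobian l μ))) μ := by
  rw [hasFDerivAt_pi']
  intro i
  refine Fin.cases ?_ (fun i => ?_) i
  · have h : HasFDerivAt (fun ν : Fin (n + 1) → ℝ => ∑ j, ν j - ∑ i, l i)
        (∑ j, (ContinuousLinearMap.proj j : (Fin (n + 1) → ℝ) →L[ℝ] ℝ)) μ :=
      (HasFDerivAt.fun_sum fun j _ => hasFDerivAt_apply j μ).sub_const _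
    refine h.congr_fderiv ?_
    ext ν
    simp [interlacingJacobian, Matrix.mulVec, dotProduct]
  · have h : HasFDerivAt (fun ν : Fin (n + 1) → ℝ => interlacingWeight l ν i) _ μ :=
      ((HasFDerivAt.finsetProd (u := Finset.univ) fun j _ =>
        ((hasFDerivAt_apply (𝕜 := ℝ) j μ).const_sub (l i))).neg.mul_const
          (∏ k ∈ Finset.univ.erase i, (l i - l k))⁻¹)
    refine h.congr_fderiv ?_
    ext ν
    simp [interlacingJacobian, Matrix.mulVec, dotProduct, Finset.mul_sum, mul_assoc]

/-- Column `j` evaluates one monic polynomial of degree `n` at the points `l i` and at infinity,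
where its value is the leading coefficient `1`. So the matrix is a projective Vandermonde matrix
times a coefficient matrix. -/
theorem det_prod_erase_sub {n : ℕ} (l : Fin n → ℝ) {μ : Fin (n + 1) → ℝ}
    (hμ : Function.Injective μ) :
    |(Matrix.of (Fin.cons (fun _ => 1) fun i j => ∏ k ∈ Finset.univ.erase j, (l i - μ k) :
      Fin (n + 1) → Fin (n + 1) → ℝ)).det| = absVandermonde l * absVandermonde μ := by
  let q : Fin (n + 1) → Polynomial ℝ := fun j =>
    ∏ k ∈ Finset.univ.erase j, (Polynomial.X - Polynomial.C (μ k))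
  have hqm : ∀ j, (q j).Monic := fun j =>
    Polynomial.monic_prod_of_monic _ _ fun i _ => Polynomial.monic_X_sub_C _
  have hqd : ∀ j, (q j).natDegree = n := fun j => by
    rw [Polynomial.natDegree_prod_of_monic _ _ fun i _ => Polynomial.monic_X_sub_C _]
    simp
  have hqe : ∀ j z, (q j).eval z = ∏ k ∈ Finset.univ.erase j, (z - μ k) := fun j z => by
    simp [q, Polynomial.eval_prod]
  let c : Matrix (Fin (n + 1)) (Fin (n + 1)) ℝ := Matrix.of fun k j => (q j).coeff k
  have heval : ∀ j z, ∑ k : Fin (n + 1), z ^ (k : ℕ) * (q j).coeff k = (q j).eval z := by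
    intro j z
    rw [Polynomial.eval_eq_sum_range' (n := n + 1) (by rw [hqd]; exact n.lt_succ_self),
      Finset.sum_range]
    exact Finset.sum_congr rfl fun _ _ => mul_comm _ _
  have hc : |c.det| = absVandermonde μ := by
    -- At the nodes `μ` the evaluation matrix is diagonal with determinant `± V(μ)²`; cancelling one
    -- factor `V(μ)` gives the determinant of `c`.
    have h1 : Matrix.vandermonde μ * c = Matrix.diagonal fun j => ∏ k ∈ Finset.univ.erase j, (μ j - μ k) := by
      ext i j
      rw [Matrix.mul_apply]
      simp only [Matrix.vandermonde_apply, c, Matrix.of_apply]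
      rw [heval, hqe]
      by_cases h : i = j
      · simp [h]
      · rw [Matrix.diagonal_apply_ne _ h]
        exact Finset.prod_eq_zero (Finset.mem_erase.2 ⟨h, Finset.mem_univ i⟩) (sub_self _)
    have h2 := congrArg (fun M => |Matrix.det M|) h1
    simp only [Matrix.det_mul, abs_mul, Matrix.det_diagonal, abs_prod_prod_erase_sub, sq] at h2
    exact mul_left_cancel₀ (absVandermonde_pos hμ).ne' h2
  let V : Matrix (Fin (n + 1)) (Fin (n + 1)) ℝ :=
    -- The first node is `(1 : 0)`, the point at infinity.
    Matrix.projVandermonde (Fin.cons 1 l) (Fin.cons 0 fun _ => 1)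
  have hV : |V.det| = absVandermonde l := by
    rw [Matrix.det_projVandermonde, Fin.prod_univ_succ, absVandermonde_eq_prod]
    simp only [Finset.abs_prod, abs_mul, Fin.prod_Ioi_zero, Fin.prod_Ioi_succ]
    simp
  have hM : (Matrix.of (Fin.cons (fun _ => 1) fun i j => ∏ k ∈ Finset.univ.erase j, (l i - μ k) :
      Fin (n + 1) → Fin (n + 1) → ℝ)) = V * c := by
    ext i j
    rw [Matrix.mul_apply]
    refine Fin.cases ?_ (fun i => ?_) i
    · rw [Finset.sum_eq_single (Fin.last n)]
      · have := (hqm j).coeff_natDegree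
        rw [hqd] at this
        simp [V, c, Matrix.projVandermonde_apply, this]
      · intro k _ hk
        have : n - (k : ℕ) ≠ 0 := by
          intro h
          apply hk
          ext
          rw [Fin.val_last]
          omega
        simp [V, Matrix.projVandermonde_apply, this]
      · simp
    · simp only [Matrix.of_apply, Fin.cons_succ, V, c, Matrix.projVandermonde_apply, one_pow, mul_one]
      rw [heval, hqe]
  rw [hM, Matrix.det_mul, abs_mul, hV, hc]

theorem abs_det_interlacingJacobian {n : ℕ} {μ : Fin (n + 1) → ℝ} {l : Fin n → ℝ}
    (h : l ∈ interlacingBox μ) :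
    |(interlacingJacobian l μ).det| = absVandermonde μ / absVandermonde l := by
  have h1 : interlacingJacobian l μ = Matrix.of fun i j =>
      (Fin.cons 1 (fun i => (∏ k ∈ Finset.univ.erase i, (l i - l k))⁻¹) : Fin (n + 1) → ℝ) i *
      (Matrix.of (Fin.cons (fun _ => 1) fun i j => ∏ k ∈ Finset.univ.erase j, (l i - μ k) :
        Fin (n + 1) → Fin (n + 1) → ℝ)) i j := by
    ext i j
    refine Fin.cases ?_ (fun i => ?_) i <;> simp [interlacingJacobian]
  rw [h1, Matrix.det_mul_column, abs_mul,
    det_prod_erase_sub l (strictAnti_of_mem_interlacingBox h).injective, Fin.prod_univ_succ]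
  simp only [Fin.cons_zero, Fin.cons_succ, one_mul]
  rw [Finset.prod_inv_distrib, abs_inv, abs_prod_prod_erase_sub]
  have := absVandermonde_pos (strictAnti_left_of_mem_interlacingBox h).injective
  field_simp

/-! ### Integrals of determinants -/

/-- Row `i` involves only the variable `x i`, so each Leibniz term factors under the product
measure. -/
theorem integral_det_pi {n : ℕ} {ν : Fin n → Measure ℝ} [∀ i, SigmaFinite (ν i)]
    {f : Fin n → ℝ → ℝ} (hf : ∀ i j, Integrable (f j) (ν i)) :
    Integrable (fun x : Fin n → ℝ => (Matrix.of fun i j => f j (x i)).det) (Measure.pi ν) ∧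
    ∫ x, (Matrix.of fun i j => f j (x i)).det ∂(Measure.pi ν) =
      (Matrix.of fun i j => ∫ t, f j t ∂(ν i)).det := by
  have hdet : ∀ M : Matrix (Fin n) (Fin n) ℝ,
      M.det = ∑ σ : Equiv.Perm (Fin n), ((Equiv.Perm.sign σ : ℤ) : ℝ) * ∏ i, M i (σ i) := by
    intro M
    rw [← Matrix.det_transpose, Matrix.det_apply']
    rfl
  have hint : ∀ σ : Equiv.Perm (Fin n), Integrable (fun x : Fin n → ℝ =>
      ((Equiv.Perm.sign σ : ℤ) : ℝ) * ∏ i, f (σ i) (x i)) (Measure.pi ν) := fun σ =>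
    (Integrable.fintype_prod_dep (f := fun i => f (σ i)) fun i => hf i (σ i)).const_mul _
  simp only [hdet, Matrix.of_apply]
  refine ⟨integrable_finsetSum _ fun σ _ => hint σ, ?_⟩
  rw [integral_finsetSum _ fun σ _ => hint σ]
  refine Finset.sum_congr rfl fun σ _ => ?_
  rw [integral_const_mul, integral_fintype_prod_eq_prod (f := fun i => f (σ i))]

/-- Subtracting from each row its predecessor leaves a first column with a single nonzero entry. -/
theorem det_vandermonde_succ_eq {n : ℕ} (μ : Fin (n + 1) → ℝ) :
    (Matrix.vandermonde μ).det =
      (Matrix.of fun i j : Fin n => μ i.succ ^ ((j : ℕ) + 1) - μ i.castSucc ^ ((j : ℕ) + 1)).det := by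
  rw [Matrix.det_eq_of_forall_row_eq_smul_add_pred (fun _ => 1) (B := Matrix.of (Fin.cons
    (fun j => μ 0 ^ (j : ℕ)) fun i j => μ i.succ ^ (j : ℕ) - μ i.castSucc ^ (j : ℕ) :
      Fin (n + 1) → Fin (n + 1) → ℝ))]
  · rw [Matrix.det_succ_column_zero, Fin.sum_univ_succ]
    simp [Matrix.submatrix]
  · intro j
    simp
  · intro i j
    simp

/-- The Vandermonde determinant has constant sign on the box, so it can be integrated without
absolute values, row by row. The entries become differences of consecutive powers divided by `j +
1`; the divisors multiply to `n!` and the differences rebuild the Vandermonde determinant of `μ`. -/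
theorem lintegral_absVandermonde_interlacingBox {n : ℕ} {μ : Fin (n + 1) → ℝ}
    (hμ : StrictAnti μ) :
    ∫⁻ l in interlacingBox μ, ENNReal.ofReal (absVandermonde l) =
      ENNReal.ofReal (absVandermonde μ / n !) := by
  set ν : Fin n → Measure ℝ := fun i => volume.restrict (Set.Ioo (μ i.succ) (μ i.castSucc)) with hν
  have hvol : (volume : Measure (Fin n → ℝ)).restrict (interlacingBox μ) = Measure.pi ν := by
    rw [interlacingBox, volume_pi, Measure.restrict_pi_pi]
  have hint : ∀ i j : Fin n, Integrable (fun t : ℝ => t ^ (j : ℕ)) (ν i) := fun i j =>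
    ((continuous_pow (j : ℕ)).integrableOn_Icc (a := μ i.succ) (b := μ i.castSucc)).mono_set
      Set.Ioo_subset_Icc_self
  obtain ⟨h1, h2⟩ := integral_det_pi (f := fun (j : Fin n) t => t ^ (j : ℕ)) hint
  have hm : ∀ i j : Fin n, ∫ t, t ^ (j : ℕ) ∂(ν i) = (((j : ℕ) : ℝ) + 1)⁻¹ *
      ((-1) * (μ i.succ ^ ((j : ℕ) + 1) - μ i.castSucc ^ ((j : ℕ) + 1))) := by
    intro i j
    have hi : μ i.succ ≤ μ i.castSucc := hμ.antitone (Fin.castSucc_lt_succ).le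
    rw [hν, ← integral_Ioc_eq_integral_Ioo, ← intervalIntegral.integral_of_le hi, integral_pow]
    ring
  have h3 : |∫ l, (Matrix.vandermonde l).det ∂(Measure.pi ν)| = absVandermonde μ / n ! := by
    change |∫ l, (Matrix.of fun i j : Fin n => l i ^ (j : ℕ)).det ∂(Measure.pi ν)| = _
    rw [h2]
    simp_rw [hm]
    rw [absVandermonde, det_vandermonde_succ_eq]
    have h4 := Matrix.det_mul_row (fun j : Fin n => (((j : ℕ) : ℝ) + 1)⁻¹) (Matrix.of fun i j : Fin n =>
      (-1) * (μ i.succ ^ ((j : ℕ) + 1) - μ i.castSucc ^ ((j : ℕ) + 1)))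
    have h5 := Matrix.det_mul_row (fun j : Fin n => (-1 : ℝ)) (Matrix.of fun i j : Fin n =>
      (μ i.succ ^ ((j : ℕ) + 1) - μ i.castSucc ^ ((j : ℕ) + 1)))
    simp only [Matrix.of_apply] at h4 h5
    rw [h4, h5, abs_mul, abs_mul, Finset.abs_prod, Finset.abs_prod]
    have h6 : ∏ j : Fin n, |(((j : ℕ) : ℝ) + 1)⁻¹| = (n ! : ℝ)⁻¹ := by
      rw [← Finset.prod_range_add_one_eq_factorial, Finset.prod_range, Nat.cast_prod,
        ← Finset.prod_inv_distrib]
      refine Finset.prod_congr rfl fun j _ => ?_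
      rw [abs_of_nonneg (by positivity)]
      push_cast
      rfl
    rw [h6]
    simp
    ring
  have hsign : ∀ l ∈ interlacingBox μ, absVandermonde l =
      (∏ i : Fin n, ∏ _j ∈ Finset.Ioi i, (-1 : ℝ)) * (Matrix.vandermonde l).det := by
    intro l hl
    rw [absVandermonde_eq_prod, Matrix.det_vandermonde, ← Finset.prod_mul_distrib]
    refine Finset.prod_congr rfl fun i _ => ?_
    rw [← Finset.prod_mul_distrib]
    refine Finset.prod_congr rfl fun j hj => ?_
    rw [abs_of_neg (sub_neg.2 (strictAnti_left_of_mem_interlacingBox hl (Finset.mem_Ioi.1 hj)))]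
    ring
  have hms : MeasurableSet (interlacingBox μ) :=
    MeasurableSet.univ_pi fun _ => measurableSet_Ioo
  have hint' : IntegrableOn (fun l : Fin n → ℝ => absVandermonde l) (interlacingBox μ) := by
    rw [IntegrableOn, hvol]
    exact Integrable.abs h1
  rw [← ofReal_integral_eq_lintegral_ofReal hint' (Filter.Eventually.of_forall fun _ => abs_nonneg _)]
  congr 1
  rw [setIntegral_congr_fun hms hsign, integral_const_mul, hvol, ← h3]
  -- The constant sign need not be evaluated: the integral is nonnegative, so it equals its absolute
  -- value, in which the sign disappears.
  have hnn : 0 ≤ (∏ i : Fin n, ∏ _j ∈ Finset.Ioi i, (-1 : ℝ)) *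
      ∫ l, (Matrix.vandermonde l).det ∂(Measure.pi ν) := by
    rw [← hvol, ← integral_const_mul, ← setIntegral_congr_fun hms hsign]
    exact integral_nonneg fun _ => abs_nonneg _
  rw [← abs_of_nonneg hnn, abs_mul, Finset.abs_prod]
  simp

/-! ### Complex Gaussian vectors -/

theorem lintegral_fin_prod_eq_prod {n : ℕ} {E : Type*} [MeasurableSpace E] (ν : Fin n → Measure E)
    [∀ i, SigmaFinite (ν i)] {f : Fin n → E → ℝ≥0∞} (hf : ∀ i, Measurable (f i)) :
    ∫⁻ x, ∏ i, f i (x i) ∂(Measure.pi ν) = ∏ i, ∫⁻ t, f i t ∂(ν i) := by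
  induction n with
  | zero => simp
  | succ n ih =>
    rw [← (measurePreserving_piFinSuccAbove ν 0).symm.lintegral_comp (by fun_prop),
      Fin.prod_univ_succ, ← ih (fun i => ν i.succ) (fun i => hf i.succ),
      ← lintegral_prod_mul (hf 0).aemeasurable
        (Finset.measurable_prod _ fun i _ => (hf i.succ).comp (measurable_pi_apply i)).aemeasurable]
    refine lintegral_congr fun x => ?_
    rw [Fin.prod_univ_succ]
    rfl

theorem pi_withDensity_eq {n : ℕ} {E : Type*} [MeasurableSpace E] (ν : Measure E) [SigmaFinite ν]
    {d : E → ℝ≥0∞} (hd : Measurable d) [SigmaFinite (ν.withDensity d)] :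
    Measure.pi (fun _ : Fin n => ν.withDensity d) =
      (Measure.pi fun _ : Fin n => ν).withDensity fun x => ∏ i, d (x i) := by
  refine (Measure.pi_eq fun s hs => ?_)
  rw [withDensity_apply _ (MeasurableSet.univ_pi hs), Measure.restrict_pi_pi,
    lintegral_fin_prod_eq_prod _ fun _ => hd]
  exact Finset.prod_congr rfl fun i _ => (withDensity_apply _ (hs i)).symm

/-- The linear isomorphism `(x, y) ↦ (x + i y) / √2`. -/
def complexScaling : (ℝ × ℝ) ≃L[ℝ] ℂ :=
  Complex.equivRealProdCLM.symm.trans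
    (LinearEquiv.smulOfNeZero ℝ ℂ (√2)⁻¹ (by positivity)).toContinuousLinearEquiv

theorem complexScaling_apply (p : ℝ × ℝ) :
    complexScaling p = ((p.1 : ℂ) + Complex.I * (p.2 : ℂ)) / ((√2 : ℝ) : ℂ) := by
  change (√2)⁻¹ • Complex.equivRealProdCLM.symm p = _
  rw [Complex.equivRealProdCLM_symm_apply, Complex.real_smul]
  push_cast
  ring

theorem normSq_complexScaling (p : ℝ × ℝ) :
    Complex.normSq (complexScaling p) = (p.1 ^ 2 + p.2 ^ 2) / 2 := by
  rw [complexScaling_apply, Complex.normSq_div, Complex.normSq_ofReal, Real.mul_self_sqrt (by norm_num),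
    mul_comm Complex.I, Complex.normSq_add_mul_I]

/-- The Lebesgue measure on `ℂ`, up to a constant. -/
def scaledVolume : Measure ℂ := (volume : Measure (ℝ × ℝ)).map complexScaling

instance : scaledVolume.IsAddHaarMeasure :=
  complexScaling.isAddHaarMeasure_map (volume : Measure (ℝ × ℝ))

instance : IsProbabilityMeasure stdComplexGaussian :=
  Measure.isProbabilityMeasure_map (by fun_prop)

theorem stdComplexGaussian_eq_map :
    stdComplexGaussian = ((volume : Measure (ℝ × ℝ)).withDensity fun p =>
      ENNReal.ofReal ((2 * Real.pi)⁻¹ * Real.exp (-((p.1 ^ 2 + p.2 ^ 2) / 2)))).map complexScaling := by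
  rw [stdComplexGaussian]
  have h1 : ((gaussianReal 0 1).prod (gaussianReal 0 1)) = (volume : Measure (ℝ × ℝ)).withDensity fun p =>
      ENNReal.ofReal ((2 * Real.pi)⁻¹ * Real.exp (-((p.1 ^ 2 + p.2 ^ 2) / 2))) := by
    rw [gaussianReal_of_var_ne_zero 0 one_ne_zero, prod_withDensity (measurable_gaussianPDF _ _)
      (measurable_gaussianPDF _ _)]
    refine congrArg (Measure.withDensity _) (funext fun p => ?_)
    rw [gaussianPDF, gaussianPDF, ← ENNReal.ofReal_mul (gaussianPDFReal_nonneg _ _ _), gaussianPDFReal,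
      gaussianPDFReal]
    congr 1
    have h2 : (√(2 * Real.pi * 1))⁻¹ * (√(2 * Real.pi * 1))⁻¹ = (2 * Real.pi)⁻¹ := by
      rw [← mul_inv, Real.mul_self_sqrt (by positivity), mul_one]
    rw [← h2]
    push_cast
    rw [mul_mul_mul_comm, ← Real.exp_add]
    congr 2
    ring
  rw [h1]
  exact congrArg (Measure.map · _) (funext fun p => (complexScaling_apply p).symm)

/-- Using the image of Lebesgue measure under the scaling as reference absorbs its Jacobian. -/
theorem stdComplexGaussian_eq_withDensity :
    stdComplexGaussian = scaledVolume.withDensity fun z =>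
      ENNReal.ofReal ((2 * Real.pi)⁻¹ * Real.exp (-Complex.normSq z)) := by
  have hm : Measurable complexScaling := complexScaling.continuous.measurable
  have hd : Measurable fun z =>
      ENNReal.ofReal ((2 * Real.pi)⁻¹ * Real.exp (-Complex.normSq z)) := by
    have := Complex.continuous_normSq.measurable
    fun_prop
  refine Measure.ext_of_lintegral _ fun f hf => ?_
  have hfm : Measurable fun p => f (complexScaling p) := hf.comp hm
  rw [stdComplexGaussian_eq_map, lintegral_map hf hm, lintegral_withDensity_eq_lintegral_mul _
    (by fun_prop) hfm, lintegral_withDensity_eq_lintegral_mul _ hd hf, scaledVolume,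
    lintegral_map (hd.mul hf) hm]
  refine lintegral_congr fun p => ?_
  simp only [Pi.mul_apply, normSq_complexScaling]

theorem pi_stdComplexGaussian_eq_withDensity (n : ℕ) :
    (Measure.pi fun _ : Fin n => stdComplexGaussian) =
      (Measure.pi fun _ : Fin n => scaledVolume).withDensity fun z =>
        ENNReal.ofReal ((2 * Real.pi)⁻¹ ^ n * Real.exp (-∑ i, Complex.normSq (z i))) := by
  have : SigmaFinite (scaledVolume.withDensity fun z =>
      ENNReal.ofReal ((2 * Real.pi)⁻¹ * Real.exp (-Complex.normSq z))) := by
    rw [← stdComplexGaussian_eq_withDensity]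
    infer_instance
  rw [stdComplexGaussian_eq_withDensity, pi_withDensity_eq]
  · refine congrArg (Measure.withDensity _) (funext fun z => ?_)
    rw [← ENNReal.ofReal_prod_of_nonneg fun _ _ => by positivity, Finset.prod_mul_distrib,
      ← Real.exp_sum, Finset.sum_neg_distrib]
    simp
  · have := Complex.continuous_normSq.measurable
    fun_prop

/-- The Gaussian density depends only on the norm, which `U` preserves, while Haar measure is
multiplied by a constant. -/
theorem lintegral_mulVec_pi_stdComplexGaussian {n : ℕ} {U : Matrix (Fin n) (Fin n) ℂ}
    (hU : star U * U = 1) {f : (Fin n → ℂ) → ℝ≥0∞} (hf : Measurable f) :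
    ∫⁻ z, f (U.mulVec z) ∂(Measure.pi fun _ : Fin n => stdComplexGaussian) =
      ∫⁻ z, f z ∂(Measure.pi fun _ : Fin n => stdComplexGaussian) := by
  let T : (Fin n → ℂ) →ₗ[ℝ] (Fin n → ℂ) := U.mulVecLin.restrictScalars ℝ
  let S : (Fin n → ℂ) →ₗ[ℝ] (Fin n → ℂ) := (star U).mulVecLin.restrictScalars ℝ
  have hST : S * T = 1 := by
    refine LinearMap.ext fun z => ?_
    change (star U).mulVec (U.mulVec z) = z
    rw [Matrix.mulVec_mulVec, hU, Matrix.one_mulVec]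
  have hdet : LinearMap.det T ≠ 0 := by
    intro h
    have := congrArg LinearMap.det hST
    rw [map_mul, h, mul_zero, map_one] at this
    exact zero_ne_one this
  have hTm : Measurable T := T.continuous_of_finiteDimensional.measurable
  set H : Measure (Fin n → ℂ) := Measure.pi fun _ => scaledVolume
  set G : (Fin n → ℂ) → ℝ≥0∞ := fun z =>
    ENNReal.ofReal ((2 * Real.pi)⁻¹ ^ n * Real.exp (-∑ i, Complex.normSq (z i))) with hG
  have hGm : Measurable G := by
    have := Complex.continuous_normSq.measurable
    fun_prop
  have hGT : ∀ z, G (T z) = G z := by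
    intro z
    have h1 : ∀ w : Fin n → ℂ, ((∑ i, Complex.normSq (w i) : ℝ) : ℂ) = star w ⬝ᵥ w := by
      intro w
      rw [Complex.ofReal_sum]
      exact Finset.sum_congr rfl fun i _ => Complex.normSq_eq_conj_mul_self
    have h2 : ∑ i, Complex.normSq (T z i) = ∑ i, Complex.normSq (z i) := by
      have : ((∑ i, Complex.normSq (T z i) : ℝ) : ℂ) = ((∑ i, Complex.normSq (z i) : ℝ) : ℂ) := by
        rw [h1, h1]
        change star (U.mulVec z) ⬝ᵥ U.mulVec z = _
        rw [Matrix.star_mulVec, Matrix.dotProduct_mulVec, Matrix.vecMul_vecMul,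
          ← Matrix.star_eq_conjTranspose, hU, Matrix.vecMul_one]
      exact_mod_cast this
    simp only [hG, h2]
  have hmap := Measure.map_linearMap_addHaar_eq_smul_addHaar H hdet
  set c := ENNReal.ofReal |(LinearMap.det T)⁻¹|
  have key : ∀ g : (Fin n → ℂ) → ℝ≥0∞, Measurable g →
      ∫⁻ z, g (T z) ∂(Measure.pi fun _ : Fin n => stdComplexGaussian) =
        c * ∫⁻ z, g z ∂(Measure.pi fun _ : Fin n => stdComplexGaussian) := by
    intro g hg
    have hgT : Measurable fun z => g (T z) := hg.comp hTm
    rw [pi_stdComplexGaussian_eq_withDensity, lintegral_withDensity_eq_lintegral_mul _ hGm hgT,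
      lintegral_withDensity_eq_lintegral_mul _ hGm hg]
    have h1 : ∀ z, (G * fun z => g (T z)) z = (G * g) (T z) := fun z => by
      simp only [Pi.mul_apply, hGT]
    simp_rw [h1]
    rw [← lintegral_map (hGm.mul hg) hTm, hmap, lintegral_smul_measure, smul_eq_mul]
  -- Testing against the constant function `1` gives `c = 1` without computing the real determinant
  -- of `U`.
  have hc : c = 1 := by
    have := key (fun _ => 1) measurable_const
    simpa using this.symm
  have := key f hf
  rwa [hc, one_mul] at this

/-- Polar coordinates followed by `t = r² / 2`; the angle contributes `2π`, which cancels the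
normalization. The squared modulus is thus exponential of rate one. -/
theorem lintegral_normSq_stdComplexGaussian {f : ℝ → ℝ≥0∞} (hf : Measurable f) :
    ∫⁻ z, f (Complex.normSq z) ∂stdComplexGaussian =
      ∫⁻ t in Set.Ioi 0, ENNReal.ofReal (Real.exp (-t)) * f t := by
  have hfn : Measurable fun z => f (Complex.normSq z) :=
    hf.comp Complex.continuous_normSq.measurable
  have hm : Measurable complexScaling := complexScaling.continuous.measurable
  have hfm : Measurable fun p => f (Complex.normSq (complexScaling p)) := hfn.comp hm
  rw [stdComplexGaussian_eq_map, lintegral_map hfn hm, lintegral_withDensity_eq_lintegral_mul _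
    (by fun_prop) hfm, ← lintegral_comp_polarCoord_symm]
  have h1 : ∀ p : ℝ × ℝ, (polarCoord.symm p).1 ^ 2 + (polarCoord.symm p).2 ^ 2 = p.1 ^ 2 := by
    intro p
    simp only [polarCoord_symm_apply]
    linear_combination p.1 ^ 2 * Real.cos_sq_add_sin_sq p.2
  simp only [Pi.mul_apply, normSq_complexScaling, h1, polarCoord_target, smul_eq_mul]
  rw [Measure.volume_eq_prod, ← Measure.prod_restrict]
  set F : ℝ → ℝ≥0∞ := fun r => ENNReal.ofReal r *
    (ENNReal.ofReal ((2 * Real.pi)⁻¹ * Real.exp (-(r ^ 2 / 2))) * f (r ^ 2 / 2)) with hF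
  have hFm : Measurable F := by fun_prop
  have h2 := lintegral_prod_mul (μ := volume.restrict (Set.Ioi (0 : ℝ)))
    (ν := volume.restrict (Set.Ioo (-Real.pi) Real.pi)) hFm.aemeasurable
    (measurable_const (a := (1 : ℝ≥0∞))).aemeasurable
  simp only [mul_one] at h2
  rw [h2]
  have himg : (fun r : ℝ => r ^ 2 / 2) '' Set.Ioi 0 = Set.Ioi 0 := by
    ext t
    constructor
    · rintro ⟨r, hr, rfl⟩
      have : 0 < r := hr
      exact Set.mem_Ioi.2 (by positivity)
    · intro ht
      have ht' : 0 < t := ht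
      refine ⟨√(2 * t), Set.mem_Ioi.2 (by positivity), ?_⟩
      simp only
      rw [Real.sq_sqrt (by positivity)]
      ring
  have h3 := lintegral_image_eq_lintegral_abs_deriv_mul (s := Set.Ioi (0 : ℝ)) measurableSet_Ioi
    (f := fun r => r ^ 2 / 2) (f' := fun r => r)
    (fun r _ => by
      have := ((hasDerivAt_pow 2 r).div_const 2).hasDerivWithinAt (s := Set.Ioi 0)
      refine this.congr_deriv ?_
      simp)
    (by
      intro r hr s hs hrs
      have hr' : 0 < r := hr
      have hs' : 0 < s := hs
      have : r ^ 2 = s ^ 2 := by simpa using hrs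
      exact (pow_left_inj₀ hr'.le hs'.le two_ne_zero).1 this)
    (fun t => ENNReal.ofReal (Real.exp (-t)) * f t)
  rw [himg] at h3
  rw [h3, ← lintegral_mul_const _ hFm]
  refine setLIntegral_congr_fun measurableSet_Ioi fun r hr => ?_
  have hr' : 0 < r := hr
  simp only [hF, lintegral_const, Measure.restrict_apply MeasurableSet.univ, Set.univ_inter,
    Real.volume_Ioo, one_mul, abs_of_pos hr']
  rw [ENNReal.ofReal_mul (by positivity), mul_assoc, mul_assoc, mul_assoc]
  congr 1
  rw [← mul_assoc, mul_comm (ENNReal.ofReal _), mul_assoc]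
  congr 1
  rw [mul_comm, mul_assoc, ← ENNReal.ofReal_mul (by linarith [Real.pi_pos])]
  rw [show (Real.pi - -Real.pi) * (2 * Real.pi)⁻¹ = 1 by field_simp; ring]
  simp

/-! ### The spectrum of a bordered diagonal matrix with Gaussian border -/

theorem measurable_bordered {β : Type*} [MeasurableSpace β] {n : ℕ} {A : β → Fin n → Fin n → ℂ}
    {v : β → Fin n → ℂ} {x : β → ℂ} (hA : Measurable A) (hv : Measurable v) (hx : Measurable x) :
    Measurable fun b => bordered (A b) (v b) (x b) := by
  refine measurable_pi_lambda _ fun i => measurable_pi_lambda _ fun j => ?_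
  refine Fin.cases ?_ (fun i => ?_) i <;> refine Fin.cases ?_ (fun j => ?_) j <;>
    simp only [bordered, Fin.cons_zero, Fin.cons_succ]
  · exact hx
  · exact continuous_star.measurable.comp (by fun_prop)
  · fun_prop
  · fun_prop

theorem measurable_comp_spectrumVec_bordered {β : Type*} [MeasurableSpace β] {n : ℕ}
    {f : (Fin (n + 1) → ℝ) → ℝ≥0∞} {A : β → Fin n → Fin n → ℂ} {v : β → Fin n → ℂ} {x : β → ℂ}
    (hf : Measurable f) (hA : Measurable A) (hv : Measurable v) (hx : Measurable x) :
    Measurable fun b => f (spectrumVec (bordered (A b) (v b) (x b))) :=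
  hf.comp (measurable_spectrumVec.comp (measurable_bordered hA hv hx))

/-- The law of the border of an unnormalized GUE matrix: a real Gaussian corner entry and an
independent vector of complex Gaussian entries. -/
def borderLaw (n : ℕ) : Measure (ℂ × (Fin n → ℂ)) :=
  ((gaussianReal 0 1).map fun x : ℝ => (x : ℂ)).prod (Measure.pi fun _ => stdComplexGaussian)

instance : IsProbabilityMeasure ((gaussianReal 0 1).map fun x : ℝ => (x : ℂ)) :=
  Measure.isProbabilityMeasure_map (by fun_prop)

instance (n : ℕ) : SFinite (borderLaw n) := by
  unfold borderLaw
  infer_instance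

/-- The expectation of `f` evaluated at the spectrum of a matrix with prescribed minor `A` and
Gaussian border. -/
def borderExpectation {n : ℕ} (f : (Fin (n + 1) → ℝ) → ℝ≥0∞) (A : Fin n → Fin n → ℂ) : ℝ≥0∞ :=
  ∫⁻ q, f (spectrumVec (bordered A q.2 q.1)) ∂(borderLaw n)

theorem measurable_borderExpectation {n : ℕ} {f : (Fin (n + 1) → ℝ) → ℝ≥0∞} (hf : Measurable f) :
    Measurable (borderExpectation f) :=
  Measurable.lintegral_prod_right' (f := fun p : (Fin n → Fin n → ℂ) × ℂ × (Fin n → ℂ) =>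
    f (spectrumVec (bordered p.1 p.2.2 p.2.1)))
    (measurable_comp_spectrumVec_bordered hf (by fun_prop) (by fun_prop) (by fun_prop))

theorem borderExpectation_eq_lintegral {n : ℕ} {f : (Fin (n + 1) → ℝ) → ℝ≥0∞} (hf : Measurable f)
    (A : Fin n → Fin n → ℂ) :
    borderExpectation f A = ∫⁻ x, ∫⁻ w, f (spectrumVec (bordered A w (x : ℝ)))
      ∂(Measure.pi fun _ => stdComplexGaussian) ∂(gaussianReal 0 1) := by
  have hm : Measurable fun q : ℂ × (Fin n → ℂ) => f (spectrumVec (bordered A q.2 q.1)) :=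
    measurable_comp_spectrumVec_bordered hf (by fun_prop) (by fun_prop) (by fun_prop)
  rw [borderExpectation, borderLaw, lintegral_prod _ hm.aemeasurable,
    lintegral_map hm.lintegral_prod_right' (by fun_prop)]

theorem borderExpectation_conj {n : ℕ} {f : (Fin (n + 1) → ℝ) → ℝ≥0∞} (hf : Measurable f)
    {A D U : Matrix (Fin n) (Fin n) ℂ} (hU : U * star U = 1) (hA : A = U * D * star U) :
    borderExpectation f (fun i j => A i j) = borderExpectation f (fun i j => D i j) := by
  rw [borderExpectation_eq_lintegral hf, borderExpectation_eq_lintegral hf]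
  refine lintegral_congr fun x => ?_
  simp_rw [spectrumVec_bordered_conj hU hA]
  have hm : Measurable fun w : Fin n → ℂ => f (spectrumVec (bordered (fun i j => D i j) w (x : ℝ))) :=
    measurable_comp_spectrumVec_bordered hf (by fun_prop) (by fun_prop) (by fun_prop)
  exact lintegral_mulVec_pi_stdComplexGaussian (by rw [star_star, hU]) hm

theorem exists_unitary_conj_diagonal_spectrumVec {n : ℕ} {A : Matrix (Fin n) (Fin n) ℂ}
    (hA : A.IsHermitian) : ∃ U : Matrix (Fin n) (Fin n) ℂ, U * star U = 1 ∧
      A = U * Matrix.diagonal (fun i => (spectrumVec (fun i j => A i j) i : ℂ)) * star U := by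
  obtain ⟨τ, hτ⟩ := exists_perm_eigenvalues_eq (n := n)
  set V : Matrix (Fin n) (Fin n) ℂ := (hA.eigenvectorUnitary : Matrix (Fin n) (Fin n) ℂ)
  have hVV : V * star V = 1 := Unitary.coe_mul_star_self _
  -- Permuting the eigenvectors puts the eigenvalues in decreasing order.
  refine ⟨V.submatrix id τ.symm, ?_, ?_⟩
  · rw [Matrix.star_eq_conjTranspose, Matrix.conjTranspose_submatrix, Matrix.submatrix_mul_equiv,
      ← Matrix.star_eq_conjTranspose, hVV, Matrix.submatrix_id_id]
  · have h1 := hA.spectral_theorem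
    rw [Unitary.conjStarAlgAut_apply, hτ A hA] at h1
    have h2 : Matrix.diagonal (fun i => (spectrumVec (fun i j => A i j) i : ℂ)) =
        (Matrix.diagonal (RCLike.ofReal ∘ spectrumVec (fun i j => A i j) ∘ τ)).submatrix
          τ.symm τ.symm := by
      rw [Matrix.submatrix_diagonal_equiv]
      congr 1
      ext i
      simp
    rw [h2, Matrix.star_eq_conjTranspose, Matrix.conjTranspose_submatrix,
      Matrix.submatrix_mul_equiv, Matrix.submatrix_mul_equiv, Matrix.submatrix_id_id,
      ← Matrix.star_eq_conjTranspose]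
    exact h1

/-- `borderExpectation` at a diagonal matrix. -/
def borderExpectationDiag {n : ℕ} (f : (Fin (n + 1) → ℝ) → ℝ≥0∞) (l : Fin n → ℝ) : ℝ≥0∞ :=
  borderExpectation f fun i j => Matrix.diagonal (fun i => (l i : ℂ)) i j

theorem measurable_borderExpectationDiag {n : ℕ} {f : (Fin (n + 1) → ℝ) → ℝ≥0∞}
    (hf : Measurable f) : Measurable (borderExpectationDiag f) := by
  refine (measurable_borderExpectation hf).comp (Continuous.measurable ?_)
  exact Continuous.matrix_diagonal (continuous_pi fun i =>
    Complex.continuous_ofReal.comp (continuous_apply i))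

/-- Unitary invariance of the Gaussian border makes the expectation a function of the spectrum of
the minor alone, so the induction can run on spectra. -/
theorem borderExpectation_eq_diag {n : ℕ} {f : (Fin (n + 1) → ℝ) → ℝ≥0∞} (hf : Measurable f)
    {A : Matrix (Fin n) (Fin n) ℂ} (hA : A.IsHermitian) :
    borderExpectation f (fun i j => A i j) =
      borderExpectationDiag f (spectrumVec fun i j => A i j) := by
  obtain ⟨U, hU, hAU⟩ := exists_unitary_conj_diagonal_spectrumVec hA
  exact borderExpectation_conj hf hU hAU

theorem lintegral_pi_stdComplexGaussian_normSq {n : ℕ} {f : (Fin n → ℝ) → ℝ≥0∞}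
    (hf : Measurable f) :
    ∫⁻ w, f (fun i => Complex.normSq (w i)) ∂(Measure.pi fun _ => stdComplexGaussian) =
      ∫⁻ r in Set.pi Set.univ fun _ => Set.Ioi 0, ENNReal.ofReal (Real.exp (-∑ i, r i)) * f r := by
  have hns : Measurable Complex.normSq := Complex.continuous_normSq.measurable
  have h1 : stdComplexGaussian.map Complex.normSq =
      (volume.restrict (Set.Ioi 0)).withDensity fun t => ENNReal.ofReal (Real.exp (-t)) := by
    refine Measure.ext_of_lintegral _ fun g hg => ?_
    rw [lintegral_map hg hns, lintegral_normSq_stdComplexGaussian hg,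
      lintegral_withDensity_eq_lintegral_mul _ (by fun_prop) hg]
    rfl
  have : IsProbabilityMeasure (stdComplexGaussian.map Complex.normSq) :=
    Measure.isProbabilityMeasure_map hns.aemeasurable
  have h2 : SigmaFinite ((volume.restrict (Set.Ioi (0 : ℝ))).withDensity fun t =>
      ENNReal.ofReal (Real.exp (-t))) := by
    rw [← h1]
    infer_instance
  have h3 := Measure.pi_map_pi (μ := fun _ : Fin n => stdComplexGaussian)
    (f := fun _ => Complex.normSq) fun _ => hns.aemeasurable
  rw [← lintegral_map (f := f) (g := fun (w : Fin n → ℂ) i => Complex.normSq (w i)) hf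
    (by fun_prop), h3, h1, pi_withDensity_eq _ (by fun_prop), ← Measure.restrict_pi_pi,
    lintegral_withDensity_eq_lintegral_mul _ (by fun_prop) hf, volume_pi]
  refine lintegral_congr fun r => ?_
  rw [Pi.mul_apply, ← ENNReal.ofReal_prod_of_nonneg fun _ _ => by positivity, ← Real.exp_sum,
    Finset.sum_neg_distrib]

/-- Joins the corner `y 0` and the squared moduli `y i.succ` into one vector, the form needed for a
change of variables in dimension `n + 1`. -/
theorem lintegral_gaussianReal_exponential {n : ℕ} {F : ℝ → (Fin n → ℝ) → ℝ≥0∞}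
    (hFm : Measurable fun p : ℝ × (Fin n → ℝ) => F p.1 p.2) (hFx : ∀ x, Measurable (F x)) :
    ∫⁻ x, (∫⁻ r in Set.pi Set.univ fun _ => Set.Ioi 0,
      ENNReal.ofReal (Real.exp (-∑ i, r i)) * F x r) ∂(gaussianReal 0 1) =
    ∫⁻ y in {y : Fin (n + 1) → ℝ | ∀ i : Fin n, 0 < y i.succ},
      ENNReal.ofReal ((√(2 * Real.pi))⁻¹ * Real.exp (-y 0 ^ 2 / 2) * Real.exp (-∑ i : Fin n, y i.succ)) *
        F (y 0) (fun i => y i.succ) := by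
  set s : Set (Fin n → ℝ) := Set.pi Set.univ fun _ => Set.Ioi 0 with hs
  have hsm : MeasurableSet s := MeasurableSet.univ_pi fun _ => measurableSet_Ioi
  have hK : Measurable fun p : ℝ × (Fin n → ℝ) =>
      ENNReal.ofReal (Real.exp (-∑ i, p.2 i)) * F p.1 p.2 :=
    Measurable.mul (by fun_prop) hFm
  rw [gaussianReal_of_var_ne_zero 0 one_ne_zero, lintegral_withDensity_eq_lintegral_mul _
    (measurable_gaussianPDF _ _) hK.lintegral_prod_right']
  have hE : Measurable fun p : ℝ × (Fin n → ℝ) => ENNReal.ofReal ((√(2 * Real.pi))⁻¹ *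
      Real.exp (-p.1 ^ 2 / 2) * Real.exp (-∑ i : Fin n, p.2 i)) * F p.1 p.2 :=
    Measurable.mul (by fun_prop) hFm
  have h3 := (measurePreserving_piFinSuccAbove (fun _ : Fin (n + 1) => (volume : Measure ℝ)) 0)
  have h4 : {y : Fin (n + 1) → ℝ | ∀ i : Fin n, 0 < y i.succ} =
      (MeasurableEquiv.piFinSuccAbove (fun _ : Fin (n + 1) => ℝ) 0) ⁻¹' (Set.univ ×ˢ s) := by
    ext y
    simp [hs, MeasurableEquiv.piFinSuccAbove_apply, Fin.tail]
  have h5 := h3.setLIntegral_comp_preimage (s := Set.univ ×ˢ s) (MeasurableSet.univ.prod hsm)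
    (f := fun p : ℝ × (Fin n → ℝ) => ENNReal.ofReal ((√(2 * Real.pi))⁻¹ * Real.exp (-p.1 ^ 2 / 2) *
      Real.exp (-∑ i : Fin n, p.2 i)) * F p.1 p.2) hE
  rw [← h4] at h5
  refine Eq.trans ?_ h5.symm
  rw [← Measure.prod_restrict, Measure.restrict_univ, lintegral_prod _ hE.aemeasurable]
  refine lintegral_congr fun x => ?_
  have hKx : Measurable fun r : Fin n → ℝ => ENNReal.ofReal (Real.exp (-∑ i, r i)) * F x r :=
    Measurable.mul (by fun_prop) (hFx x)
  rw [Pi.mul_apply, ← lintegral_const_mul _ hKx]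
  refine lintegral_congr fun r => ?_
  rw [← mul_assoc, gaussianPDF, ← ENNReal.ofReal_mul (gaussianPDFReal_nonneg _ _ _), gaussianPDFReal]
  simp

theorem borderExpectationDiag_eq_lintegral {n : ℕ} {f : (Fin (n + 1) → ℝ) → ℝ≥0∞}
    (hf : Measurable f) (l : Fin n → ℝ) :
    borderExpectationDiag f l = ∫⁻ y in {y : Fin (n + 1) → ℝ | ∀ i : Fin n, 0 < y i.succ},
      ENNReal.ofReal ((√(2 * Real.pi))⁻¹ * Real.exp (-y 0 ^ 2 / 2) * Real.exp (-∑ i : Fin n, y i.succ)) *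
        f (spectrumVec (bordered (fun i j => Matrix.diagonal (fun i => (l i : ℂ)) i j)
          (fun i => (√(y i.succ) : ℝ)) (y 0 : ℝ))) := by
  set D : Fin n → Fin n → ℂ := fun i j => Matrix.diagonal (fun i => (l i : ℂ)) i j with hD
  set F : ℝ → (Fin n → ℝ) → ℝ≥0∞ := fun x r =>
    f (spectrumVec (bordered D (fun i => (√(r i) : ℝ)) (x : ℝ))) with hF
  have hFm : Measurable fun p : ℝ × (Fin n → ℝ) => F p.1 p.2 := 
    measurable_comp_spectrumVec_bordered hf (by fun_prop) (by fun_prop) (by fun_prop)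
  have hFx : ∀ x, Measurable (F x) := fun x =>
    measurable_comp_spectrumVec_bordered hf (by fun_prop) (by fun_prop) (by fun_prop)
  have h1 : ∀ (x : ℝ) (w : Fin n → ℂ), f (spectrumVec (bordered D w x)) =
      F x fun i => Complex.normSq (w i) := by
    intro x w
    refine congrArg f (spectrumVec_congr fun z => ?_)
    rw [det_sub_bordered_diagonal, det_sub_bordered_diagonal]
    congr 1
    refine Finset.sum_congr rfl fun i _ => ?_
    congr 1
    have h2 : ∀ z : ℂ, star z * z = ((Complex.normSq z : ℝ) : ℂ) := fun z => by
      rw [Complex.normSq_eq_conj_mul_self]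
      rfl
    rw [h2, h2, Complex.normSq_ofReal, Real.mul_self_sqrt (Complex.normSq_nonneg _)]
  refine Eq.trans ?_ (lintegral_gaussianReal_exponential hFm hFx)
  rw [borderExpectationDiag, borderExpectation_eq_lintegral hf]
  refine lintegral_congr fun x => ?_
  rw [← lintegral_pi_stdComplexGaussian_normSq (hFx x)]
  exact lintegral_congr fun w => h1 x w

theorem measurableSet_setOf_mem_interlacingBox {n : ℕ} :
    MeasurableSet {p : (Fin n → ℝ) × (Fin (n + 1) → ℝ) | p.1 ∈ interlacingBox p.2} := by
  simp only [interlacingBox, Set.mem_univ_pi, Set.mem_Ioo, Set.ofPred_forall, Set.ofPred_and]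
  exact MeasurableSet.iInter fun i =>
    (measurableSet_lt (by fun_prop) (by fun_prop)).inter (measurableSet_lt (by fun_prop) (by fun_prop))

/-- Substitution `y = interlacingMap l μ`. Only the inclusion of its image in the domain of
integration is used, hence an inequality. -/
theorem lintegral_interlacing_le_borderExpectationDiag {n : ℕ} {f : (Fin (n + 1) → ℝ) → ℝ≥0∞}
    (hf : Measurable f) (l : Fin n → ℝ) :
    ∫⁻ μ in {μ | l ∈ interlacingBox μ}, ENNReal.ofReal (absVandermonde μ / absVandermonde l *
        ((√(2 * Real.pi))⁻¹ * Real.exp ((∑ i, l i ^ 2) / 2 - (∑ j, μ j ^ 2) / 2))) * f μ ≤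
      borderExpectationDiag f l := by
  have hs : MeasurableSet {μ : Fin (n + 1) → ℝ | l ∈ interlacingBox μ} :=
    measurable_prodMk_left (x := l) measurableSet_setOf_mem_interlacingBox
  rw [borderExpectationDiag_eq_lintegral hf]
  refine le_trans (le_of_eq ?_) (lintegral_mono_set
    (s := interlacingMap l '' {μ | l ∈ interlacingBox μ}) ?_)
  · rw [lintegral_image_eq_lintegral_abs_det_fderiv_mul volume hs
      (fun μ _ => (hasFDerivAt_interlacingMap l μ).hasFDerivWithinAt) (injOn_interlacingMap l)]
    refine setLIntegral_congr_fun hs fun μ hμ => ?_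
    have hw : ∀ i, Complex.normSq ((√(interlacingWeight l μ i) : ℝ) : ℂ) = interlacingWeight l μ i :=
      fun i => by rw [Complex.normSq_ofReal, Real.mul_self_sqrt (interlacingWeight_pos hμ i).le]
    have h1 := spectrumVec_bordered_diagonal hμ hw
    simp only [interlacingMap, Fin.cons_zero, Fin.cons_succ, h1]
    rw [LinearMap.det_toContinuousLinearMap, LinearMap.det_toLin', abs_det_interlacingJacobian hμ,
      ENNReal.ofReal_mul (div_nonneg (absVandermonde_nonneg _) (absVandermonde_nonneg _)),
      mul_assoc (ENNReal.ofReal _), mul_assoc (√(2 * Real.pi))⁻¹, ← Real.exp_add]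
    congr 5
    -- Corner energy plus the sum of the weights is half the gain in the sum of squares.
    linarith [sum_sq_eq_of_mem_interlacingBox hμ]
  · rintro _ ⟨μ, hμ, rfl⟩ i
    exact interlacingWeight_pos hμ i

/-! ### Lower bound for the law of the ordered eigenvalues -/

namespace IsUnnormalizedGUE

variable {Ω : Type*} [MeasurableSpace Ω] {P : Measure Ω}

theorem aemeasurable_apply {N : ℕ} {a : Ω → Matrix (Fin N) (Fin N) ℂ}
    (ha : IsUnnormalizedGUE P a) (i j : Fin N) : AEMeasurable (fun ω => a ω i j) P := by
  have hlt : ∀ i j, j < i → AEMeasurable (fun ω => a ω i j) P := fun i j h =>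
    (ha.offDiag i j h).aemeasurable
  rcases lt_trichotomy i j with h | rfl | h
  · refine (continuous_star.measurable.comp_aemeasurable (hlt j i h)).congr ?_
    exact Filter.Eventually.of_forall fun ω => (ha.isHermitian ω).apply i j
  · refine (Complex.measurable_ofReal.comp_aemeasurable (ha.diag i).aemeasurable).congr ?_
    refine Filter.Eventually.of_forall fun ω => ?_
    exact Complex.conj_eq_iff_re.1 ((ha.isHermitian ω).apply i i)
  · exact hlt i j h

theorem aemeasurable {N : ℕ} {a : Ω → Matrix (Fin N) (Fin N) ℂ}
    (ha : IsUnnormalizedGUE P a) : AEMeasurable (fun ω i j => a ω i j) P :=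
  aemeasurable_pi_lambda _ fun i => aemeasurable_pi_lambda _ fun j => ha.aemeasurable_apply i j

theorem submatrix_succ {n : ℕ} {a : Ω → Matrix (Fin (n + 1)) (Fin (n + 1)) ℂ}
    (ha : IsUnnormalizedGUE P a) :
    IsUnnormalizedGUE P fun ω => (a ω).submatrix Fin.succ Fin.succ where
  isHermitian ω := (ha.isHermitian ω).submatrix _
  indep := by
    let g : {p : Fin n × Fin n // p.2 ≤ p.1} →
        {p : Fin (n + 1) × Fin (n + 1) // p.2 ≤ p.1} :=
      fun p => ⟨(p.1.1.succ, p.1.2.succ), Fin.succ_le_succ_iff.2 p.2⟩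
    have hg : Function.Injective g := by
      rintro ⟨⟨i, j⟩, hp⟩ ⟨⟨i', j'⟩, hq⟩ h
      simpa [g] using h
    exact ha.indep.precomp hg
  diag i := ha.diag i.succ
  offDiag i j h := ha.offDiag i.succ j.succ (Fin.succ_lt_succ_iff.2 h)

theorem bordered_eq {n : ℕ} {a : Ω → Matrix (Fin (n + 1)) (Fin (n + 1)) ℂ}
    (ha : IsUnnormalizedGUE P a) (ω : Ω) :
    bordered (fun i j => a ω i.succ j.succ) (fun i => a ω i.succ 0) (a ω 0 0) =
      fun i j => a ω i j := by
  ext i j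
  refine Fin.cases ?_ (fun i => ?_) i <;> refine Fin.cases ?_ (fun j => ?_) j
  · simp [bordered]
  · simpa [bordered] using (ha.isHermitian ω).apply 0 j.succ
  · simp [bordered]
  · simp [bordered]

theorem map_border_eq [IsProbabilityMeasure P] {n : ℕ}
    {a : Ω → Matrix (Fin (n + 1)) (Fin (n + 1)) ℂ} (ha : IsUnnormalizedGUE P a) :
    P.map (fun ω => (a ω 0 0, fun i : Fin n => a ω i.succ 0)) = borderLaw n := by
  let g : Fin (n + 1) → {p : Fin (n + 1) × Fin (n + 1) // p.2 ≤ p.1} :=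
    fun i => ⟨(i, 0), Fin.zero_le i⟩
  have hg : Function.Injective g := fun i j h => by simpa [g] using h
  have h1 : iIndepFun (fun i ω => a ω i 0) P := ha.indep.precomp hg
  have hm : ∀ i, AEMeasurable (fun ω => a ω i 0) P := fun i => ha.aemeasurable_apply i 0
  have h2 := h1.map_fun_eq_pi_map hm
  have : ∀ i, IsProbabilityMeasure (P.map fun ω => a ω i 0) := fun i =>
    Measure.isProbabilityMeasure_map (hm i)
  have h3 := (measurePreserving_piFinSuccAbove (fun i => P.map fun ω => a ω i 0) 0).map_eq
  rw [← h2, AEMeasurable.map_map_of_aemeasurable (by fun_prop) (by fun_prop)] at h3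
  have h4 : P.map (fun ω => a ω 0 0) = (gaussianReal 0 1).map fun x : ℝ => (x : ℂ) := by
    rw [← (ha.diag 0).map_eq, AEMeasurable.map_map_of_aemeasurable (by fun_prop)
      (ha.diag 0).aemeasurable]
    refine congrArg (Measure.map · P) (funext fun ω => ?_)
    exact (Complex.conj_eq_iff_re.1 ((ha.isHermitian ω).apply 0 0)).symm
  have h5 : ∀ i : Fin n, P.map (fun ω => a ω i.succ 0) = stdComplexGaussian := fun i =>
    (ha.offDiag i.succ 0 i.succ_pos).map_eq
  simp only [Fin.zero_succAbove, h4, h5] at h3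
  exact h3

/-- The independent lower-triangular entries split into those of column `0` and the rest; the latter
determine the whole minor by selfadjointness. -/
theorem indepFun_border [IsProbabilityMeasure P] {n : ℕ}
    {a : Ω → Matrix (Fin (n + 1)) (Fin (n + 1)) ℂ} (ha : IsUnnormalizedGUE P a) :
    IndepFun (fun ω (i j : Fin n) => a ω i.succ j.succ)
      (fun ω => (a ω 0 0, fun i : Fin n => a ω i.succ 0)) P := by
  classical
  set S : Finset {p : Fin (n + 1) × Fin (n + 1) // p.2 ≤ p.1} :=
    Finset.univ.filter fun p => p.1.2 ≠ 0
  set T : Finset {p : Fin (n + 1) × Fin (n + 1) // p.2 ≤ p.1} :=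
    Finset.univ.filter fun p => p.1.2 = 0
  have hST : Disjoint S T := Finset.disjoint_left.2 fun p hp hq =>
    (Finset.mem_filter.1 hp).2 (Finset.mem_filter.1 hq).2
  have h1 := ha.indep.indepFun_finset₀ S T hST fun p => ha.aemeasurable_apply _ _
  have hSm : ∀ i j : Fin n, ∀ h : j ≤ i,
      (⟨(i.succ, j.succ), Fin.succ_le_succ_iff.2 h⟩ :
        {p : Fin (n + 1) × Fin (n + 1) // p.2 ≤ p.1}) ∈ S := fun i j h =>
    Finset.mem_filter.2 ⟨Finset.mem_univ _, Fin.succ_ne_zero j⟩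
  have hTm : ∀ i : Fin (n + 1), (⟨(i, 0), Fin.zero_le i⟩ :
        {p : Fin (n + 1) × Fin (n + 1) // p.2 ≤ p.1}) ∈ T := fun i =>
    Finset.mem_filter.2 ⟨Finset.mem_univ _, rfl⟩
  let F : (S → ℂ) → Fin n → Fin n → ℂ := fun g i j =>
    if h : j ≤ i then g ⟨_, hSm i j h⟩ else star (g ⟨_, hSm j i (le_of_not_ge h)⟩)
  let G : (T → ℂ) → ℂ × (Fin n → ℂ) := fun g => (g ⟨_, hTm 0⟩, fun i => g ⟨_, hTm i.succ⟩)
  have hF : Measurable F := by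
    refine measurable_pi_lambda _ fun i => measurable_pi_lambda _ fun j => ?_
    by_cases h : j ≤ i
    · simp only [F, h, dif_pos]
      exact measurable_pi_apply _
    · simp only [F, h, dif_neg, not_false_eq_true]
      exact continuous_star.measurable.comp (measurable_pi_apply _)
  have hG : Measurable G := by fun_prop
  have h2 := h1.comp hF hG
  convert! h2 using 1
  ext ω i j
  by_cases h : j ≤ i
  · simp [F, h]
  · simp only [F, h, dif_neg, not_false_eq_true, Function.comp_apply]
    exact ((ha.isHermitian ω).apply i.succ j.succ).symm

theorem lintegral_spectrumVec_succ [IsProbabilityMeasure P] {n : ℕ}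
    {a : Ω → Matrix (Fin (n + 1)) (Fin (n + 1)) ℂ} (ha : IsUnnormalizedGUE P a)
    {f : (Fin (n + 1) → ℝ) → ℝ≥0∞} (hf : Measurable f) :
    ∫⁻ ω, f (spectrumVec fun i j => a ω i j) ∂P =
      ∫⁻ ω, borderExpectationDiag f (spectrumVec fun i j => a ω i.succ j.succ) ∂P := by
  have hA : AEMeasurable (fun ω (i j : Fin n) => a ω i.succ j.succ) P :=
    ha.submatrix_succ.aemeasurable
  have hq : AEMeasurable (fun ω => (a ω 0 0, fun i : Fin n => a ω i.succ 0)) P :=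
    (ha.aemeasurable_apply 0 0).prodMk
      (aemeasurable_pi_lambda _ fun i => ha.aemeasurable_apply i.succ 0)
  have hlaw := (indepFun_iff_map_prod_eq_prod_map_map hA hq).1 ha.indepFun_border
  rw [ha.map_border_eq] at hlaw
  have hm : Measurable fun p : (Fin n → Fin n → ℂ) × ℂ × (Fin n → ℂ) =>
      f (spectrumVec (bordered p.1 p.2.2 p.2.1)) :=
    measurable_comp_spectrumVec_bordered hf (by fun_prop) (by fun_prop) (by fun_prop)
  have h1 := lintegral_map' (μ := P) hm.aemeasurable (hA.prodMk hq)
  rw [hlaw, lintegral_prod _ hm.aemeasurable] at h1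
  have h2 := lintegral_map' (μ := P) (measurable_borderExpectation hf).aemeasurable hA
  refine Eq.trans (lintegral_congr fun ω => ?_) (h1.symm.trans (h2.trans (lintegral_congr fun ω => ?_)))
  · rw [ha.bordered_eq]
  · exact borderExpectation_eq_diag hf (ha.submatrix_succ.isHermitian ω)

end IsUnnormalizedGUE

/-- The density of the ordered eigenvalues of an unnormalized GUE matrix on the set of decreasing
sequences. -/
def orderedDensity {n : ℕ} (μ : Fin n → ℝ) : ℝ :=
  (∏ k ∈ Finset.range n, (√(2 * Real.pi))⁻¹ * (k ! : ℝ)⁻¹) *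
    (absVandermonde μ ^ 2 * Real.exp (-(∑ i, μ i ^ 2) / 2))

theorem continuous_absVandermonde {n : ℕ} :
    Continuous (absVandermonde : (Fin n → ℝ) → ℝ) := by
  refine continuous_abs.comp (Continuous.matrix_det ?_)
  refine continuous_matrix fun i j => ?_
  simp only [Matrix.vandermonde_apply]
  fun_prop

theorem measurable_orderedDensity {n : ℕ} : Measurable (orderedDensity : (Fin n → ℝ) → ℝ) := by
  unfold orderedDensity
  have := (continuous_absVandermonde (n := n)).measurable
  fun_prop

theorem measurableSet_strictAnti {n : ℕ} : MeasurableSet {μ : Fin n → ℝ | StrictAnti μ} := by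
  simp only [StrictAnti, Set.ofPred_forall]
  refine MeasurableSet.iInter fun i => MeasurableSet.iInter fun j => MeasurableSet.iInter fun _ => ?_
  exact measurableSet_lt (by fun_prop) (by fun_prop)

/-- One of the two factors `V(μ)` is written as `n!` times the integral of `V(l)` over the
interlacing box; this `n!` cancels the last factorial in the constant. -/
theorem orderedDensity_succ_eq {n : ℕ} {μ : Fin (n + 1) → ℝ} (hμ : StrictAnti μ) :
    ENNReal.ofReal (orderedDensity μ) = ∫⁻ l in interlacingBox μ,
      ENNReal.ofReal (((∏ k ∈ Finset.range n, (√(2 * Real.pi))⁻¹ * (k ! : ℝ)⁻¹) *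
        (√(2 * Real.pi))⁻¹) * (absVandermonde μ * Real.exp (-(∑ i, μ i ^ 2) / 2)) *
          absVandermonde l) := by
  have hC : 0 ≤ ((∏ k ∈ Finset.range n, (√(2 * Real.pi))⁻¹ * (k ! : ℝ)⁻¹) *
        (√(2 * Real.pi))⁻¹) * (absVandermonde μ * Real.exp (-(∑ i, μ i ^ 2) / 2)) := by
    have := absVandermonde_nonneg μ
    positivity
  simp_rw [ENNReal.ofReal_mul hC]
  rw [lintegral_const_mul _ continuous_absVandermonde.measurable.ennreal_ofReal,
    lintegral_absVandermonde_interlacingBox hμ, ← ENNReal.ofReal_mul hC, orderedDensity,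
    Finset.prod_range_succ]
  congr 1
  ring

/-- Expand the density over interlacing `l`, exchange the integrals, and bound the inner one by the
border expectation; the induction hypothesis applies with that expectation as test function. -/
theorem lintegral_orderedDensity_le {Ω : Type*} [MeasurableSpace Ω] {P : Measure Ω}
    [IsProbabilityMeasure P] {N : ℕ} {a : Ω → Matrix (Fin N) (Fin N) ℂ}
    (ha : IsUnnormalizedGUE P a) {f : (Fin N → ℝ) → ℝ≥0∞} (hf : Measurable f) :
    ∫⁻ μ in {μ | StrictAnti μ}, ENNReal.ofReal (orderedDensity μ) * f μ ≤
      ∫⁻ ω, f (spectrumVec fun i j => a ω i j) ∂P := by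
  induction N with
  | zero =>
    have h1 : ∀ μ : Fin 0 → ℝ, ENNReal.ofReal (orderedDensity μ) * f μ = f default := fun μ => by
      rw [Subsingleton.elim μ default]
      simp [orderedDensity, absVandermonde]
    have h2 : ∀ ω, f (spectrumVec fun i j => a ω i j) = f default := fun ω =>
      congrArg f (Subsingleton.elim _ _)
    simp_rw [h1, h2]
    refine (setLIntegral_le_lintegral _ _).trans ?_
    rw [lintegral_const, lintegral_const, volume_pi, Measure.pi_of_empty]
    simp
  | succ n ih =>
    rw [ha.lintegral_spectrumVec_succ hf]
    refine le_trans ?_ (ih ha.submatrix_succ (measurable_borderExpectationDiag hf))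
    set C : ℝ := (∏ k ∈ Finset.range n, (√(2 * Real.pi))⁻¹ * (k ! : ℝ)⁻¹) * (√(2 * Real.pi))⁻¹
      with hC
    have hC0 : 0 ≤ C := by positivity
    let k : (Fin n → ℝ) × (Fin (n + 1) → ℝ) → ℝ≥0∞ := fun p =>
      ENNReal.ofReal (C * (absVandermonde p.2 * Real.exp (-(∑ i, p.2 i ^ 2) / 2)) *
        absVandermonde p.1) * f p.2
    have hk : Measurable k := by
      have h1 := (continuous_absVandermonde (n := n)).measurable
      have h2 := (continuous_absVandermonde (n := n + 1)).measurable
      fun_prop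
    let B : Set ((Fin n → ℝ) × (Fin (n + 1) → ℝ)) := {p | p.1 ∈ interlacingBox p.2}
    have hB : MeasurableSet B := measurableSet_setOf_mem_interlacingBox
    have hBk : Measurable (B.indicator k) := hk.indicator hB
    calc ∫⁻ μ in {μ | StrictAnti μ}, ENNReal.ofReal (orderedDensity μ) * f μ
        ≤ ∫⁻ μ in {μ | StrictAnti μ}, ∫⁻ l in {l | StrictAnti l}, B.indicator k (l, μ) := by
          refine setLIntegral_mono' measurableSet_strictAnti fun μ hμ => ?_
          have hbox : MeasurableSet (interlacingBox μ) :=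
            MeasurableSet.univ_pi fun _ => measurableSet_Ioo
          have hsub : interlacingBox μ ⊆ {l | StrictAnti l} := fun l hl =>
            strictAnti_left_of_mem_interlacingBox hl
          refine le_trans (le_of_eq ?_) (lintegral_mono_set hsub)
          rw [orderedDensity_succ_eq hμ, ← hC, ← lintegral_mul_const _ ?_]
          · refine setLIntegral_congr_fun hbox fun l hl => ?_
            exact (Set.indicator_of_mem (s := B) (a := (l, μ)) hl k).symm
          · have h1 := (continuous_absVandermonde (n := n)).measurable
            fun_prop
      _ = ∫⁻ l in {l | StrictAnti l}, ∫⁻ μ in {μ | StrictAnti μ}, B.indicator k (l, μ) :=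
          lintegral_lintegral_swap (hBk.comp measurable_swap).aemeasurable
      _ ≤ ∫⁻ l in {l | StrictAnti l},
            ENNReal.ofReal (orderedDensity l) * borderExpectationDiag f l := by
          refine setLIntegral_mono' measurableSet_strictAnti fun l hl => ?_
          have hs : MeasurableSet {μ : Fin (n + 1) → ℝ | l ∈ interlacingBox μ} :=
            measurable_prodMk_left (x := l) hB
          have hd : 0 ≤ orderedDensity l := by
            unfold orderedDensity
            positivity
          refine le_trans ?_ (mul_le_mul_right (lintegral_interlacing_le_borderExpectationDiag hf l) _)
          rw [← lintegral_const_mul' _ _ ENNReal.ofReal_ne_top, ← lintegral_indicator hs]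
          refine (setLIntegral_le_lintegral _ _).trans (lintegral_mono fun μ => ?_)
          by_cases hμ : l ∈ interlacingBox μ
          · rw [Set.indicator_of_mem (s := B) (a := (l, μ)) hμ k,
              Set.indicator_of_mem (s := {μ | l ∈ interlacingBox μ}) hμ, ← mul_assoc,
              ← ENNReal.ofReal_mul hd]
            refine le_of_eq (congrArg (fun t => ENNReal.ofReal t * f μ) ?_)
            have hl0 := absVandermonde_pos hl.injective
            -- The integrand factors as the density of `l` times the transition density from `l` to
            -- `μ`.
            have he : Real.exp (-(∑ i, μ i ^ 2) / 2) = Real.exp (-(∑ i, l i ^ 2) / 2) *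
                Real.exp ((∑ i, l i ^ 2) / 2 - (∑ j, μ j ^ 2) / 2) := by
              rw [← Real.exp_add]
              congr 1
              ring
            simp only [he, orderedDensity, hC]
            field_simp
          · rw [Set.indicator_of_notMem (s := B) (a := (l, μ)) hμ k]
            exact zero_le

/-! ### Hermite functions -/

/-- The Hermite polynomials with real coefficients. -/
def realHermite (n : ℕ) : Polynomial ℝ := (Polynomial.hermite n).map (Int.castRingHom ℝ)

theorem realHermite_monic (n : ℕ) : (realHermite n).Monic := (Polynomial.hermite_monic n).map _

theorem natDegree_realHermite (n : ℕ) : (realHermite n).natDegree = n := by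
  rw [realHermite, (Polynomial.hermite_monic n).natDegree_map, Polynomial.natDegree_hermite]

theorem realHermite_succ (n : ℕ) : realHermite (n + 1) =
    Polynomial.X * realHermite n - Polynomial.derivative (realHermite n) := by
  simp [realHermite, Polynomial.hermite_succ, Polynomial.derivative_map]

theorem hermiteH_eq_eval (n : ℕ) (x : ℝ) : hermiteH n x = (realHermite n).eval x := by
  rw [hermiteH, realHermite, Polynomial.eval_map, Polynomial.aeval_def]
  rfl

theorem integrable_eval_mul_exp (p : Polynomial ℝ) :
    Integrable fun x : ℝ => p.eval x * Real.exp (-(1 / 2) * x ^ 2) := by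
  simp only [Polynomial.eval_eq_sum_range, Finset.sum_mul, mul_assoc]
  refine integrable_finsetSum _ fun k _ => Integrable.const_mul ?_ _
  have := integrable_rpow_mul_exp_neg_mul_sq (b := 1 / 2) (by norm_num) (s := k)
    (by have : (0 : ℝ) ≤ k := k.cast_nonneg
        linarith)
  simpa only [Real.rpow_natCast] using this

/-- Integration by parts, since `-H_{n+1} exp (-x²/2)` is the derivative of `H_n exp (-x²/2)`.
Iterating moves all derivatives onto `p`, which yields orthogonality and norms. -/
theorem integral_eval_mul_realHermite_succ (p : Polynomial ℝ) (n : ℕ) :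
    ∫ x : ℝ, (p * realHermite (n + 1)).eval x * Real.exp (-(1 / 2) * x ^ 2) =
      ∫ x : ℝ, (Polynomial.derivative p * realHermite n).eval x * Real.exp (-(1 / 2) * x ^ 2) := by
  have hv : ∀ x : ℝ, HasDerivAt (fun x => (realHermite n).eval x * Real.exp (-(1 / 2) * x ^ 2))
      (-((realHermite (n + 1)).eval x * Real.exp (-(1 / 2) * x ^ 2))) x := by
    intro x
    have h1 : HasDerivAt (fun x : ℝ => -(1 / 2) * x ^ 2) (-x) x := by
      refine ((hasDerivAt_pow 2 x).const_mul (-(1 / 2))).congr_deriv ?_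
      simp
    refine (((realHermite n).hasDerivAt x).mul h1.exp).congr_deriv ?_
    rw [realHermite_succ]
    simp only [Polynomial.eval_sub, Polynomial.eval_mul, Polynomial.eval_X]
    ring
  have h := integral_mul_deriv_eq_deriv_mul_of_integrable (u := fun x => p.eval x)
    (u' := fun x => (Polynomial.derivative p).eval x) (fun x _ => p.hasDerivAt x) (fun x _ => hv x)
    (by
      refine (integrable_eval_mul_exp (-(p * realHermite (n + 1)))).congr ?_
      refine Filter.Eventually.of_forall fun x => ?_
      simp [mul_assoc])
    (by
      refine (integrable_eval_mul_exp (Polynomial.derivative p * realHermite n)).congr ?_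
      refine Filter.Eventually.of_forall fun x => ?_
      simp [mul_assoc])
    (by
      refine (integrable_eval_mul_exp (p * realHermite n)).congr ?_
      refine Filter.Eventually.of_forall fun x => ?_
      simp [mul_assoc])
  simp only [mul_neg, integral_neg, neg_inj] at h
  simp only [Polynomial.eval_mul, mul_assoc]
  exact h

theorem integral_eval_mul_realHermite (p : Polynomial ℝ) (n : ℕ) :
    ∫ x : ℝ, (p * realHermite n).eval x * Real.exp (-(1 / 2) * x ^ 2) =
      ∫ x : ℝ, (Polynomial.derivative^[n] p).eval x * Real.exp (-(1 / 2) * x ^ 2) := by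
  induction n generalizing p with
  | zero => simp [realHermite]
  | succ n ih => rw [integral_eval_mul_realHermite_succ, ih, Function.iterate_succ_apply]

theorem integral_realHermite_mul_of_lt {m n : ℕ} (h : m < n) :
    ∫ x : ℝ, (realHermite m * realHermite n).eval x * Real.exp (-(1 / 2) * x ^ 2) = 0 := by
  rw [integral_eval_mul_realHermite,
    Polynomial.iterate_derivative_eq_zero (by rwa [natDegree_realHermite])]
  simp

theorem integral_realHermite_mul_self (n : ℕ) :
    ∫ x : ℝ, (realHermite n * realHermite n).eval x * Real.exp (-(1 / 2) * x ^ 2) =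
      √(2 * Real.pi) * n ! := by
  have hd : Polynomial.derivative^[n] (realHermite n) = Polynomial.C (n ! : ℝ) := by
    have h1 : Polynomial.derivative^[n] (realHermite n).eraseLead = 0 := by
      rcases n.eq_zero_or_pos with rfl | hn
      · simpa [realHermite] using Polynomial.eraseLead_C (1 : ℝ)
      · refine Polynomial.iterate_derivative_eq_zero ?_
        have := Polynomial.eraseLead_natDegree_le (realHermite n)
        rw [natDegree_realHermite] at this
        omega
    rw [← Polynomial.eraseLead_add_C_mul_X_pow (realHermite n), iterate_map_add, h1,
      (realHermite_monic n).leadingCoeff, natDegree_realHermite, map_one, one_mul, zero_add,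
      Polynomial.iterate_derivative_X_pow_eq_C_mul, Nat.descFactorial_self]
    simp
  rw [integral_eval_mul_realHermite, hd]
  simp only [Polynomial.eval_C]
  rw [integral_const_mul, integral_gaussian, mul_comm]
  congr 2
  ring

/-- The normalization constant of the `n`-th Hermite function. -/
def hermiteConst (n : ℕ) : ℝ := (2 * Real.pi) ^ (-(1 / 4) : ℝ) * (n ! : ℝ) ^ (-(1 / 2) : ℝ)

theorem hermiteConst_sq (n : ℕ) : hermiteConst n ^ 2 = (√(2 * Real.pi))⁻¹ * (n ! : ℝ)⁻¹ := by
  have h1 : (0 : ℝ) ≤ 2 * Real.pi := by positivity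
  have h2 : (0 : ℝ) ≤ n ! := by positivity
  rw [hermiteConst, mul_pow, ← Real.rpow_natCast, ← Real.rpow_natCast, ← Real.rpow_mul h1,
    ← Real.rpow_mul h2, Real.sqrt_eq_rpow, ← Real.rpow_neg h1, ← Real.rpow_neg_one (n ! : ℝ)]
  norm_num

theorem hermitePsi_eq (n : ℕ) (x : ℝ) :
    hermitePsi n x = hermiteConst n * (Real.exp (-(1 / 4) * x ^ 2) * (realHermite n).eval x) := by
  rw [hermitePsi, hermiteH_eq_eval, hermiteConst, mul_assoc]

theorem hermitePsi_mul (m n : ℕ) (x : ℝ) : hermitePsi m x * hermitePsi n x =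
    hermiteConst m * hermiteConst n *
      ((realHermite m * realHermite n).eval x * Real.exp (-(1 / 2) * x ^ 2)) := by
  have : Real.exp (-(1 / 2) * x ^ 2) = Real.exp (-(1 / 4) * x ^ 2) * Real.exp (-(1 / 4) * x ^ 2) := by
    rw [← Real.exp_add]
    congr 1
    ring
  rw [hermitePsi_eq, hermitePsi_eq, this, Polynomial.eval_mul]
  ring

theorem integrable_hermitePsi_mul (m n : ℕ) :
    Integrable fun x => hermitePsi m x * hermitePsi n x := by
  simp only [hermitePsi_mul]
  exact (integrable_eval_mul_exp _).const_mul _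

theorem integral_hermitePsi_mul_of_ne {m n : ℕ} (h : m ≠ n) :
    ∫ x, hermitePsi m x * hermitePsi n x = 0 := by
  wlog hmn : m < n generalizing m n
  · simp_rw [mul_comm (hermitePsi m _)]
    exact this h.symm (by omega)
  simp only [hermitePsi_mul]
  rw [integral_const_mul, integral_realHermite_mul_of_lt hmn, mul_zero]

theorem integral_hermitePsi_mul_self (n : ℕ) :
    ∫ x, hermitePsi n x * hermitePsi n x = 1 := by
  simp only [hermitePsi_mul]
  rw [integral_const_mul, integral_realHermite_mul_self, ← sq, hermiteConst_sq]
  have : (0 : ℝ) < √(2 * Real.pi) := by positivity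
  field_simp

theorem continuous_hermitePsi (n : ℕ) : Continuous (hermitePsi n) := by
  have : hermitePsi n = fun x =>
      hermiteConst n * (Real.exp (-(1 / 4) * x ^ 2) * (realHermite n).eval x) :=
    funext (hermitePsi_eq n)
  rw [this]
  have := (realHermite n).continuous
  fun_prop

/-! ### Squared determinants of orthonormal functions -/

/-- Composing with a transposition shows that the sum does not depend on `i`; then sum over all
positions. -/
theorem card_mul_sum_perm_apply {n : ℕ} (c : Fin n → ℝ) (i : Fin n) :
    (n : ℝ) * ∑ σ : Equiv.Perm (Fin n), c (σ i) = n ! * ∑ k, c k := by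
  have h1 : ∀ j, ∑ σ : Equiv.Perm (Fin n), c (σ j) = ∑ σ : Equiv.Perm (Fin n), c (σ i) := fun j =>
    Fintype.sum_equiv (Equiv.mulRight (Equiv.swap i j)) _ _ fun σ => by simp
  have h2 : ∑ j, ∑ σ : Equiv.Perm (Fin n), c (σ j) = n ! * ∑ k, c k := by
    rw [Finset.sum_comm]
    simp_rw [fun σ : Equiv.Perm (Fin n) => Equiv.sum_comp σ c]
    simp [Fintype.card_perm]
  rw [← h2]
  simp [h1]

/-- Orthonormality is assumed in every coordinate except `i₀`. Distinct permutations differ at some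
other coordinate, so only diagonal terms survive in the double Leibniz sum. With `ν i₀` restricted
to a set this gives the one-point marginal, and unrestricted the total mass. -/
theorem integral_det_sq_pi {n : ℕ} {ν : Fin n → Measure ℝ} [∀ i, SigmaFinite (ν i)]
    {f : Fin n → ℝ → ℝ} (hf : ∀ i j k, Integrable (fun t => f j t * f k t) (ν i)) (i₀ : Fin n)
    (horth : ∀ i, i ≠ i₀ → ∀ j k, j ≠ k → ∫ t, f j t * f k t ∂(ν i) = 0)
    (hnorm : ∀ i, i ≠ i₀ → ∀ j, ∫ t, f j t * f j t ∂(ν i) = 1) :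
    Integrable (fun x : Fin n → ℝ => (Matrix.of fun i j => f j (x i)).det ^ 2) (Measure.pi ν) ∧
    (n : ℝ) * ∫ x, (Matrix.of fun i j => f j (x i)).det ^ 2 ∂(Measure.pi ν) =
      n ! * ∑ k, ∫ t, f k t * f k t ∂(ν i₀) := by
  have hdet : ∀ x : Fin n → ℝ, (Matrix.of fun i j => f j (x i)).det ^ 2 =
      ∑ σ : Equiv.Perm (Fin n), ∑ τ : Equiv.Perm (Fin n),
        (((Equiv.Perm.sign σ : ℤ) : ℝ) * ((Equiv.Perm.sign τ : ℤ) : ℝ)) *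
          ∏ i, (f (σ i) (x i) * f (τ i) (x i)) := by
    intro x
    rw [← Matrix.det_transpose, Matrix.det_apply', sq, Finset.sum_mul_sum]
    refine Finset.sum_congr rfl fun σ _ => Finset.sum_congr rfl fun τ _ => ?_
    rw [Finset.prod_mul_distrib]
    simp only [Matrix.transpose_apply, Matrix.of_apply]
    ring
  have hint : ∀ σ τ : Equiv.Perm (Fin n), Integrable (fun x : Fin n → ℝ =>
      (((Equiv.Perm.sign σ : ℤ) : ℝ) * ((Equiv.Perm.sign τ : ℤ) : ℝ)) *
          ∏ i, (f (σ i) (x i) * f (τ i) (x i))) (Measure.pi ν) := fun σ τ =>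
    (Integrable.fintype_prod_dep (f := fun i t => f (σ i) t * f (τ i) t)
      fun i => hf i (σ i) (τ i)).const_mul _
  simp only [hdet]
  refine ⟨integrable_finsetSum _ fun σ _ => integrable_finsetSum _ fun τ _ => hint σ τ, ?_⟩
  rw [integral_finsetSum _ fun σ _ => integrable_finsetSum _ fun τ _ => hint σ τ,
    ← card_mul_sum_perm_apply (fun k => ∫ t, f k t * f k t ∂(ν i₀)) i₀]
  congr 1
  refine Finset.sum_congr rfl fun σ _ => ?_
  rw [integral_finsetSum _ fun τ _ => hint σ τ, Finset.sum_eq_single σ]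
  · rw [integral_const_mul, integral_fintype_prod_eq_prod (f := fun i t => f (σ i) t * f (σ i) t),
      ← Finset.mul_prod_erase _ _ (Finset.mem_univ i₀),
      Finset.prod_eq_one fun i hi => hnorm i (Finset.ne_of_mem_erase hi) (σ i), mul_one]
    have : (((Equiv.Perm.sign σ : ℤ) : ℝ) * ((Equiv.Perm.sign σ : ℤ) : ℝ)) = 1 := by
      norm_cast
      simp
    rw [this, one_mul]
  · intro τ _ hτ
    rw [integral_const_mul, integral_fintype_prod_eq_prod (f := fun i t => f (σ i) t * f (τ i) t)]
    -- Permutations agreeing off one point agree there too.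
    obtain ⟨i, hi, hne⟩ : ∃ i, i ≠ i₀ ∧ σ i ≠ τ i := by
      by_contra! h
      refine hτ (Equiv.ext fun i => ?_)
      by_cases hi : i = i₀
      · subst hi
        obtain ⟨j, hj⟩ := τ.surjective (σ i)
        by_cases hji : j = i
        · rw [← hji, hj, hji]
        · exact absurd (σ.injective ((h j hji).trans hj)) hji
      · exact (h i hi).symm
    rw [Finset.prod_eq_zero (Finset.mem_univ i) (horth i hi _ _ hne), mul_zero]
  · simp

/-- Monic polynomials of degrees `0, …, n - 1` have the same evaluation determinant as the
monomials. -/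
theorem det_hermitePsi {n : ℕ} (μ : Fin n → ℝ) :
    (Matrix.of fun i j : Fin n => hermitePsi j (μ i)).det =
      (∏ j : Fin n, hermiteConst j) * ((∏ i, Real.exp (-(1 / 4) * μ i ^ 2)) *
        (Matrix.vandermonde μ).det) := by
  rw [Matrix.det_eval_matrixOfPolynomials_eq_det_vandermonde μ (fun j : Fin n => realHermite j)
    (fun j => natDegree_realHermite j) (fun j => realHermite_monic j), ← Matrix.det_mul_column,
    ← Matrix.det_mul_row]
  simp only [hermitePsi_eq, Matrix.of_apply]

theorem det_hermitePsi_sq {n : ℕ} (μ : Fin n → ℝ) :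
    (Matrix.of fun i j : Fin n => hermitePsi j (μ i)).det ^ 2 = orderedDensity μ := by
  rw [det_hermitePsi, orderedDensity, mul_pow, mul_pow, absVandermonde, sq_abs, ← Real.exp_sum,
    ← Real.exp_nat_mul, ← Finset.prod_pow, Finset.prod_range fun k => (√(2 * Real.pi))⁻¹ * (k ! : ℝ)⁻¹]
  simp_rw [hermiteConst_sq]
  rw [mul_comm (Real.exp _)]
  congr 3
  rw [← Finset.mul_sum]
  push_cast
  ring

theorem det_hermiteKernel {n : ℕ} (μ : Fin n → ℝ) :
    (Matrix.of fun i j => hermiteKernel n (μ i) (μ j)).det = orderedDensity μ := by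
  have : (Matrix.of fun i j => hermiteKernel n (μ i) (μ j)) =
      (Matrix.of fun i j : Fin n => hermitePsi j (μ i)) *
        (Matrix.of fun i j : Fin n => hermitePsi j (μ i)).transpose := by
    ext i j
    simp [Matrix.mul_apply, hermiteKernel, Finset.sum_range]
  rw [this, Matrix.det_mul, Matrix.det_transpose, ← sq, det_hermitePsi_sq]

theorem lintegral_orderedDensity_coordinate {n : ℕ} (i₀ : Fin n) (B : Set ℝ) :
    (n : ℝ≥0∞) * ∫⁻ μ in {μ : Fin n → ℝ | μ i₀ ∈ B}, ENNReal.ofReal (orderedDensity μ) =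
      n ! * ∫⁻ x in B, ENNReal.ofReal (hermiteKernel n x x) := by
  classical
  set s : Fin n → Set ℝ := fun i => if i = i₀ then B else Set.univ with hs
  have hset : {μ : Fin n → ℝ | μ i₀ ∈ B} = Set.pi Set.univ s := by
    ext μ
    simp only [Set.mem_ofPred_eq, Set.mem_univ_pi, hs]
    constructor
    · intro h i
      by_cases hi : i = i₀
      · simpa [hi] using h
      · simp [hi]
    · intro h
      simpa using h i₀
  have hne : ∀ i, i ≠ i₀ → (volume : Measure ℝ).restrict (s i) = volume := fun i hi => by
    simp [hs, hi]
  obtain ⟨h1, h2⟩ := integral_det_sq_pi (ν := fun i => volume.restrict (s i))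
    (f := fun j : Fin n => hermitePsi j) (fun i j k => (integrable_hermitePsi_mul j k).restrict) i₀
    (fun i hi j k hjk => by
      rw [hne i hi]
      exact integral_hermitePsi_mul_of_ne fun h => hjk (Fin.ext h))
    (fun i hi j => by
      rw [hne i hi]
      exact integral_hermitePsi_mul_self j)
  simp only [det_hermitePsi_sq] at h1 h2
  have h0 : ∀ μ : Fin n → ℝ, 0 ≤ orderedDensity μ := fun μ => by
    rw [← det_hermitePsi_sq]
    positivity
  have hker : ∀ x, hermiteKernel n x x = ∑ k : Fin n, hermitePsi k x * hermitePsi k x := fun x => by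
    rw [hermiteKernel, Finset.sum_range]
  have hk0 : ∀ x, 0 ≤ hermiteKernel n x x := fun x => by
    rw [hker]
    exact Finset.sum_nonneg fun _ _ => mul_self_nonneg _
  have hki : Integrable (fun x => hermiteKernel n x x) (volume.restrict B) := by
    simp only [hker]
    exact integrable_finsetSum _ fun k _ => (integrable_hermitePsi_mul k k).restrict
  rw [hset, volume_pi, Measure.restrict_pi_pi, ← ofReal_integral_eq_lintegral_ofReal h1
    (Filter.Eventually.of_forall h0), ← ofReal_integral_eq_lintegral_ofReal hki
    (Filter.Eventually.of_forall hk0), ← ENNReal.ofReal_natCast, ← ENNReal.ofReal_natCast,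
    ← ENNReal.ofReal_mul (by positivity), ← ENNReal.ofReal_mul (by positivity), h2]
  congr 2
  simp only [hker]
  rw [integral_finsetSum (Finset.univ : Finset (Fin n)) (f := fun k x => hermitePsi k x * hermitePsi k x)
    fun k _ => (integrable_hermitePsi_mul k k).restrict]
  simp [hs]

/-! ### The laws of the ordered and unordered eigenvalues -/

theorem orderedDensity_nonneg {n : ℕ} (μ : Fin n → ℝ) : 0 ≤ orderedDensity μ := by
  unfold orderedDensity
  positivity

theorem absVandermonde_comp_perm {n : ℕ} (μ : Fin n → ℝ) (σ : Equiv.Perm (Fin n)) :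
    absVandermonde (μ ∘ σ) = absVandermonde μ := by
  have h : Matrix.vandermonde (μ ∘ σ) = (Matrix.vandermonde μ).submatrix σ id := rfl
  rw [absVandermonde, h, Matrix.det_permute, abs_mul, absVandermonde]
  rcases Int.units_eq_one_or (Equiv.Perm.sign σ) with h | h <;> simp [h]

theorem orderedDensity_comp_perm {n : ℕ} (μ : Fin n → ℝ) (σ : Equiv.Perm (Fin n)) :
    orderedDensity (μ ∘ σ) = orderedDensity μ := by
  rw [orderedDensity, absVandermonde_comp_perm, orderedDensity]
  simp only [Function.comp_apply]
  rw [Equiv.sum_comp σ fun i => μ i ^ 2]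

theorem measurePreserving_comp_perm {n : ℕ} (σ : Equiv.Perm (Fin n)) :
    MeasurePreserving (fun μ : Fin n → ℝ => μ ∘ σ) volume volume := by
  convert! volume_measurePreserving_piCongrLeft (fun _ : Fin n => ℝ) σ.symm using 1
  ext μ i
  have h := MeasurableEquiv.piCongrLeft_apply_apply (β := fun _ : Fin n => ℝ) (e := σ.symm) μ (σ i)
  rw [Equiv.symm_apply_apply] at h
  exact h.symm

theorem exists_perm_strictAnti {n : ℕ} {μ : Fin n → ℝ} (h : Function.Injective μ) :
    ∃ σ : Equiv.Perm (Fin n), StrictAnti (μ ∘ σ) := by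
  refine ⟨Tuple.sort fun i => -μ i, ?_⟩
  have h1 := Tuple.monotone_sort fun i => -μ i
  refine Antitone.strictAnti_of_injective (fun i j hij => ?_) (h.comp (Equiv.injective _))
  simpa using h1 hij

theorem perm_eq_of_strictAnti {n : ℕ} {μ : Fin n → ℝ} {σ τ : Equiv.Perm (Fin n)}
    (hσ : StrictAnti (μ ∘ σ)) (hτ : StrictAnti (μ ∘ τ)) : σ = τ := by
  have h1 : μ ∘ σ = μ ∘ τ := antitone_eq_of_prod_sub_eq hσ.antitone hτ.antitone fun k => by
    simp only [Function.comp_apply]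
    rw [Equiv.prod_comp σ fun i => (k : ℝ) - μ i, Equiv.prod_comp τ fun i => (k : ℝ) - μ i]
  have hinj : Function.Injective μ := by
    have := hσ.injective.comp σ.symm.injective
    simpa [Function.comp_assoc] using this
  exact Equiv.ext fun i => hinj (congrFun h1 i)

/-- The chambers given by the orderings of the coordinates tile the vectors with distinct
coordinates. On the remaining vectors the density vanishes, so no null-set argument is needed. -/
theorem sum_perm_lintegral_orderedDensity {n : ℕ} {f : (Fin n → ℝ) → ℝ≥0∞} (hf : Measurable f) :
    ∑ σ : Equiv.Perm (Fin n), ∫⁻ μ in {μ | StrictAnti μ},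
      ENNReal.ofReal (orderedDensity μ) * f (μ ∘ σ) =
      ∫⁻ μ, ENNReal.ofReal (orderedDensity μ) * f μ := by
  have hm : Measurable fun μ => ENNReal.ofReal (orderedDensity μ) * f μ :=
    measurable_orderedDensity.ennreal_ofReal.mul hf
  have h1 : ∀ σ : Equiv.Perm (Fin n), ∫⁻ μ in {μ | StrictAnti μ},
      ENNReal.ofReal (orderedDensity μ) * f (μ ∘ σ) =
      ∫⁻ μ, {μ | StrictAnti (μ ∘ σ.symm)}.indicator
        (fun μ => ENNReal.ofReal (orderedDensity μ) * f μ) μ := by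
    intro σ
    have hs : MeasurableSet {μ : Fin n → ℝ | StrictAnti (μ ∘ σ.symm)} :=
      (measurePreserving_comp_perm σ.symm).measurable measurableSet_strictAnti
    rw [← (measurePreserving_comp_perm σ).lintegral_comp (hm.indicator hs),
      ← lintegral_indicator measurableSet_strictAnti]
    refine lintegral_congr fun μ => ?_
    have : (μ ∘ σ) ∘ σ.symm = μ := by
      ext i
      simp
    simp only [Set.indicator, Set.mem_ofPred_eq, this, orderedDensity_comp_perm]
  simp_rw [h1]
  rw [← lintegral_finsetSum _ fun σ _ => hm.indicator
    ((measurePreserving_comp_perm σ.symm).measurable measurableSet_strictAnti)]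
  refine lintegral_congr fun μ => ?_
  by_cases hμ : Function.Injective μ
  · obtain ⟨σ, hσ⟩ := exists_perm_strictAnti hμ
    rw [Finset.sum_eq_single σ.symm]
    · exact Set.indicator_of_mem (by simpa using hσ) _
    · intro τ _ hτ
      refine Set.indicator_of_notMem (fun h => hτ ?_) _
      rw [← perm_eq_of_strictAnti (σ := τ.symm) h hσ, Equiv.symm_symm]
    · simp
  · have h0 : orderedDensity μ = 0 := by
      have : (Matrix.vandermonde μ).det = 0 := by
        by_contra h
        exact hμ (Matrix.det_vandermonde_ne_zero_iff.1 h)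
      simp [orderedDensity, absVandermonde, this]
    simp [h0, Set.indicator]

theorem lintegral_orderedDensity {n : ℕ} (hn : 1 ≤ n) :
    ∫⁻ μ : Fin n → ℝ, ENNReal.ofReal (orderedDensity μ) = n ! := by
  have h1 := lintegral_orderedDensity_coordinate (⟨0, hn⟩ : Fin n) Set.univ
  have h2 : ∫⁻ x, ENNReal.ofReal (hermiteKernel n x x) = n := by
    simp only [hermiteKernel]
    rw [← ofReal_integral_eq_lintegral_ofReal
      (integrable_finsetSum _ fun k _ => integrable_hermitePsi_mul k k)
      (Filter.Eventually.of_forall fun x => Finset.sum_nonneg fun _ _ => mul_self_nonneg _),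
      integral_finsetSum _ fun k _ => integrable_hermitePsi_mul k k]
    simp [integral_hermitePsi_mul_self]
  simp only [Set.mem_univ, Set.ofPred_true, Measure.restrict_univ, h2] at h1
  rw [mul_comm] at h1
  exact (ENNReal.mul_left_inj (by simp; omega) (by simp)).1 h1

/-- The lower bound becomes an equality because both measures have mass one. -/
theorem IsUnnormalizedGUE.lintegral_spectrumVec {Ω : Type*} [MeasurableSpace Ω] {P : Measure Ω}
    [IsProbabilityMeasure P] {N : ℕ} (hN : 1 ≤ N) {a : Ω → Matrix (Fin N) (Fin N) ℂ}
    (ha : IsUnnormalizedGUE P a) {f : (Fin N → ℝ) → ℝ≥0∞} (hf : Measurable f) :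
    ∫⁻ ω, f (spectrumVec fun i j => a ω i j) ∂P =
      ∫⁻ μ in {μ | StrictAnti μ}, ENNReal.ofReal (orderedDensity μ) * f μ := by
  have hs : AEMeasurable (fun ω => spectrumVec fun i j => a ω i j) P :=
    measurable_spectrumVec.comp_aemeasurable ha.aemeasurable
  have hd := (measurable_orderedDensity (n := N)).ennreal_ofReal
  set ν : Measure (Fin N → ℝ) := (volume.restrict {μ | StrictAnti μ}).withDensity fun μ =>
    ENNReal.ofReal (orderedDensity μ) with hν
  have hνf : ∀ g : (Fin N → ℝ) → ℝ≥0∞, Measurable g → ∫⁻ μ, g μ ∂ν =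
      ∫⁻ μ in {μ | StrictAnti μ}, ENNReal.ofReal (orderedDensity μ) * g μ := fun g hg => by
    rw [hν, lintegral_withDensity_eq_lintegral_mul _ hd hg]
    rfl
  have : IsProbabilityMeasure (P.map fun ω => spectrumVec fun i j => a ω i j) :=
    Measure.isProbabilityMeasure_map hs
  have hν1 : IsProbabilityMeasure ν := by
    refine ⟨?_⟩
    -- All `N!` chambers carry equal mass and the total is `N!`, so the decreasing chamber has mass
    -- one.
    have h1 := sum_perm_lintegral_orderedDensity (n := N) (f := fun _ => 1) measurable_const
    simp only [mul_one, Finset.sum_const, Finset.card_univ, Fintype.card_perm, Fintype.card_fin,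
      nsmul_eq_mul, lintegral_orderedDensity hN] at h1
    have h2 := hνf (fun _ => 1) measurable_const
    simp only [lintegral_one, mul_one] at h2
    rw [h2]
    have h3 : (N ! : ℝ≥0∞) ≠ 0 := by simpa using N.factorial_ne_zero
    exact (ENNReal.mul_right_inj h3 (by simp)).1 (h1.trans (mul_one _).symm)
  have hle : ν ≤ P.map fun ω => spectrumVec fun i j => a ω i j := by
    refine Measure.le_iff.2 fun B hB => ?_
    have h1 := lintegral_orderedDensity_le ha (f := B.indicator 1) (measurable_one.indicator hB)
    rw [← hνf _ (measurable_one.indicator hB), lintegral_indicator_one hB,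
      ← lintegral_map' (f := B.indicator 1) (measurable_one.indicator hB).aemeasurable hs,
      lintegral_indicator_one hB] at h1
    exact h1
  have heq := Measure.eq_of_le_of_isProbabilityMeasure hle
  rw [← hνf f hf, heq, lintegral_map' hf.aemeasurable hs]

theorem IsUnnormalizedGUE.aemeasurable_eigenvalues {Ω : Type*} [MeasurableSpace Ω] {P : Measure Ω}
    {N : ℕ} {a : Ω → Matrix (Fin N) (Fin N) ℂ} (ha : IsUnnormalizedGUE P a) :
    AEMeasurable (fun ω => (ha.isHermitian ω).eigenvalues) P := by
  obtain ⟨τ, hτ⟩ := exists_perm_eigenvalues_eq (n := N)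
  have hs : AEMeasurable (fun ω => spectrumVec fun i j => a ω i j) P :=
    measurable_spectrumVec.comp_aemeasurable ha.aemeasurable
  simp_rw [fun ω => hτ _ (ha.isHermitian ω)]
  exact aemeasurable_pi_lambda _ fun i => (measurable_pi_apply (τ i)).comp_aemeasurable hs

theorem unorderedEigenvalueLaw_eq {Ω : Type*} [MeasurableSpace Ω] {P : Measure Ω}
    [IsProbabilityMeasure P] {N : ℕ} (hN : 1 ≤ N) {a : Ω → Matrix (Fin N) (Fin N) ℂ}
    (ha : IsUnnormalizedGUE P a) :
    unorderedEigenvalueLaw P a ha.isHermitian =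
      volume.withDensity fun μ => ENNReal.ofReal (1 / (N ! : ℝ) * orderedDensity μ) := by
  obtain ⟨τ, hτ⟩ := exists_perm_eigenvalues_eq (n := N)
  have hd := (measurable_orderedDensity (n := N)).ennreal_ofReal
  have hperm : ∀ σ : Equiv.Perm (Fin N), Measurable fun μ : Fin N → ℝ => μ ∘ σ := fun σ =>
    (measurePreserving_comp_perm σ).measurable
  refine Measure.ext_of_lintegral _ fun f hf => ?_
  rw [unorderedEigenvalueLaw, lintegral_smul_measure, lintegral_finsetSum_measure,
    lintegral_withDensity_eq_lintegral_mul _ (by have := measurable_orderedDensity (n := N); fun_prop) hf]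
  have h1 : ∀ σ : Equiv.Perm (Fin N),
      ∫⁻ μ, f μ ∂(P.map fun ω (i : Fin N) => (ha.isHermitian ω).eigenvalues (σ i)) =
      ∫⁻ μ in {μ | StrictAnti μ}, ENNReal.ofReal (orderedDensity μ) * f (μ ∘ ⇑(τ * σ)) := by
    intro σ
    have hσ : AEMeasurable (fun ω (i : Fin N) => (ha.isHermitian ω).eigenvalues (σ i)) P :=
      (hperm σ).comp_aemeasurable ha.aemeasurable_eigenvalues
    rw [lintegral_map' hf.aemeasurable hσ,
      ← ha.lintegral_spectrumVec hN (f := fun μ => f (μ ∘ ⇑(τ * σ))) (hf.comp (hperm _))]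
    refine lintegral_congr fun ω => ?_
    rw [hτ _ (ha.isHermitian ω)]
    rfl
  simp_rw [h1]
  have hm : Measurable fun μ => ENNReal.ofReal (orderedDensity μ) * f μ := hd.mul hf
  -- Averaging over all labellings removes the arbitrary permutation `τ`.
  have h2 := Equiv.sum_comp (Equiv.mulLeft τ) fun σ : Equiv.Perm (Fin N) => ∫⁻ μ in {μ | StrictAnti μ},
    ENNReal.ofReal (orderedDensity μ) * f (μ ∘ σ)
  simp only [Equiv.coe_mulLeft] at h2
  rw [h2, sum_perm_lintegral_orderedDensity hf, smul_eq_mul,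
    ← lintegral_const_mul _ hm]
  refine lintegral_congr fun μ => ?_
  rw [Pi.mul_apply, ENNReal.ofReal_mul (by positivity), ← mul_assoc, one_div,
    ENNReal.ofReal_inv_of_pos (by positivity), ENNReal.ofReal_natCast]

theorem averagedEigenvalueDistribution_eq {Ω : Type*} [MeasurableSpace Ω] {P : Measure Ω}
    [IsProbabilityMeasure P] {N : ℕ} (hN : 1 ≤ N) {a : Ω → Matrix (Fin N) (Fin N) ℂ}
    (ha : IsUnnormalizedGUE P a) :
    averagedEigenvalueDistribution P a ha.isHermitian =
      volume.withDensity fun x => ENNReal.ofReal (1 / (N : ℝ) * hermiteKernel N x x) := by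
  obtain ⟨τ, hτ⟩ := exists_perm_eigenvalues_eq (n := N)
  have hN0 : (N : ℝ≥0∞) ≠ 0 := by simp; omega
  have hNt : (N : ℝ≥0∞) ≠ ∞ := by simp
  have hF0 : (N ! : ℝ≥0∞) ≠ 0 := by simpa using N.factorial_ne_zero
  have hFt : (N ! : ℝ≥0∞) ≠ ∞ := by simp
  have hEm : Measurable fun μ : Fin N → ℝ =>
      (N : ℝ≥0∞)⁻¹ • ∑ i : Fin N, Measure.dirac (μ i) := by
    refine Measure.measurable_of_measurable_coe _ fun B hB => ?_
    simp only [Measure.smul_apply, Measure.finsetSum_apply, Measure.dirac_apply' _ hB, smul_eq_mul]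
    refine Measurable.const_mul (Finset.measurable_sum _ fun i _ => ?_) _
    exact (measurable_one.indicator hB).comp (measurable_pi_apply i)
  have hκ : AEMeasurable (fun ω => eigenvalueDistribution (ha.isHermitian ω)) P :=
    hEm.comp_aemeasurable ha.aemeasurable_eigenvalues
  ext B hB
  -- The number of eigenvalues in `B` is symmetric, so the ordered law may be replaced by the full
  -- symmetric density divided by `N!`.
  set f : (Fin N → ℝ) → ℝ≥0∞ := fun μ => ∑ i, B.indicator 1 (μ i) with hf
  have hBi : ∀ i : Fin N, Measurable fun μ : Fin N → ℝ => B.indicator (1 : ℝ → ℝ≥0∞) (μ i) :=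
    fun i => (measurable_one.indicator hB).comp (measurable_pi_apply i)
  have hfm : Measurable f := Finset.measurable_sum _ fun i _ => hBi i
  have hfp : ∀ (μ : Fin N → ℝ) (σ : Equiv.Perm (Fin N)), f (μ ∘ σ) = f μ := fun μ σ =>
    Equiv.sum_comp σ fun i => B.indicator (1 : ℝ → ℝ≥0∞) (μ i)
  have hd := (measurable_orderedDensity (n := N)).ennreal_ofReal
  have h1 := sum_perm_lintegral_orderedDensity hfm
  simp only [hfp, Finset.sum_const, Finset.card_univ, Fintype.card_perm, Fintype.card_fin,
    nsmul_eq_mul] at h1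
  have h2 : ∀ i : Fin N, (N : ℝ≥0∞) *
      ∫⁻ μ, ENNReal.ofReal (orderedDensity μ) * B.indicator (1 : ℝ → ℝ≥0∞) (μ i) =
        N ! * ∫⁻ x in B, ENNReal.ofReal (hermiteKernel N x x) := by
    intro i
    have hBs : MeasurableSet {μ : Fin N → ℝ | μ i ∈ B} := measurable_pi_apply i hB
    rw [← lintegral_orderedDensity_coordinate i B, ← lintegral_indicator hBs]
    congr 1
    refine lintegral_congr fun μ => ?_
    by_cases h : μ i ∈ B <;> simp [Set.indicator, h]
  have h3 : ∫⁻ μ, ENNReal.ofReal (orderedDensity μ) * f μ =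
      N ! * ∫⁻ x in B, ENNReal.ofReal (hermiteKernel N x x) := by
    simp only [hf, Finset.mul_sum]
    have hm : ∀ i : Fin N, Measurable fun μ : Fin N → ℝ =>
        ENNReal.ofReal (orderedDensity μ) * B.indicator (1 : ℝ → ℝ≥0∞) (μ i) := fun i => hd.mul (hBi i)
    rw [lintegral_finsetSum _ fun i _ => hm i]
    refine (ENNReal.mul_right_inj hN0 hNt).1 ?_
    rw [Finset.mul_sum, Finset.sum_congr rfl fun i _ => h2 i]
    simp
  have h4 : ∫⁻ ω, f (spectrumVec fun i j => a ω i j) ∂P =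
      ∫⁻ x in B, ENNReal.ofReal (hermiteKernel N x x) := by
    rw [ha.lintegral_spectrumVec hN hfm]
    exact (ENNReal.mul_right_inj hF0 hFt).1 (h1.trans h3)
  have hkm : Measurable fun x => hermiteKernel N x x := by
    simp only [hermiteKernel]
    exact Finset.measurable_sum _ fun k _ =>
      (continuous_hermitePsi k).measurable.mul (continuous_hermitePsi k).measurable
  rw [averagedEigenvalueDistribution, Measure.bind_apply hB hκ, withDensity_apply _ hB]
  have h5 : ∀ ω, eigenvalueDistribution (ha.isHermitian ω) B =
      (N : ℝ≥0∞)⁻¹ * f (spectrumVec fun i j => a ω i j) := by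
    intro ω
    rw [← hfp _ τ, ← hτ _ (ha.isHermitian ω)]
    simp only [eigenvalueDistribution, Measure.smul_apply, Measure.finsetSum_apply,
      Measure.dirac_apply' _ hB, smul_eq_mul, hf]
  simp_rw [h5]
  rw [lintegral_const_mul' _ _ (by simpa using hN0), h4, ← lintegral_const_mul _ hkm.ennreal_ofReal]
  refine lintegral_congr fun x => ?_
  have hNpos : (0 : ℝ) < N := by exact_mod_cast hN
  rw [ENNReal.ofReal_mul (by positivity), one_div, ENNReal.ofReal_inv_of_pos hNpos,
    ENNReal.ofReal_natCast]

theorem hermitePsi_sq (k : ℕ) (x : ℝ) : hermitePsi k x ^ 2 =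
    (√(2 * Real.pi))⁻¹ * (1 / (k ! : ℝ) * hermiteH k x ^ 2 * Real.exp (-x ^ 2 / 2)) := by
  rw [sq, hermitePsi_mul, ← sq, hermiteConst_sq, Polynomial.eval_mul, ← hermiteH_eq_eval,
    show -(1 / 2) * x ^ 2 = -x ^ 2 / 2 by ring]
  ring

end

theorem theorem7p20 {Ω : Type*} [MeasurableSpace Ω] (P : Measure Ω) [IsProbabilityMeasure P]
    {N : ℕ} (hN : 1 ≤ N) (a : Ω → Matrix (Fin N) (Fin N) ℂ) (ha : IsUnnormalizedGUE P a) :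
    HasLebesgueDensity (unorderedEigenvalueLaw P a ha.isHermitian)
      (fun μ : Fin N → ℝ =>
        1 / (N ! : ℝ) * Matrix.det (Matrix.of fun i j => hermiteKernel N (μ i) (μ j))) ∧
    HasLebesgueDensity (averagedEigenvalueDistribution P a ha.isHermitian)
      (fun μ : ℝ => 1 / (N : ℝ) * hermiteKernel N μ μ) ∧
    (∀ μ : ℝ, 1 / (N : ℝ) * hermiteKernel N μ μ =
      1 / (N : ℝ) * ∑ k ∈ Finset.range N, hermitePsi k μ ^ 2) ∧
    (∀ μ : ℝ, 1 / (N : ℝ) * ∑ k ∈ Finset.range N, hermitePsi k μ ^ 2 =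
      1 / √(2 * Real.pi) * (1 / (N : ℝ)) *
        ∑ k ∈ Finset.range N, 1 / (k ! : ℝ) * hermiteH k μ ^ 2 * Real.exp (-μ ^ 2 / 2)) := by
  refine ⟨?_, ⟨?_, fun x => ?_, averagedEigenvalueDistribution_eq hN ha⟩, fun x => ?_, fun x => ?_⟩
  · simp only [det_hermiteKernel]
    exact ⟨measurable_orderedDensity.const_mul _,
      fun μ => mul_nonneg (by positivity) (orderedDensity_nonneg μ), unorderedEigenvalueLaw_eq hN ha⟩
  · simp only [hermiteKernel]
    exact (Finset.measurable_sum _ fun k _ => (continuous_hermitePsi k).measurable.mul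
      (continuous_hermitePsi k).measurable).const_mul _
  · exact mul_nonneg (by positivity) (Finset.sum_nonneg fun _ _ => mul_self_nonneg _)
  · simp only [hermiteKernel, sq]
  · simp_rw [hermitePsi_sq]
    rw [← Finset.mul_sum]
    ring
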